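/- Let $a,b\in\mathbb C\setminus\{0\}$, $c\in\mathbb R$, and let $A(\lambda)=\begin{pmatrix} c & a\lambda^{-1}+\overline b\\ b+\overline a\lambda & -c\end{pmatrix}$ for $\lambda\in\mathbb C^*=\mathbb C\setminus\{0\}$ (a Delaunay residue). Let $\nu_1,\nu_2$ be the zeros of $\det A$, $|\nu_1|\le|\nu_2|$, let $p$ be the point of the unit circle $\mathbb S^1$ on the segment from $\nu_1$ to $\nu_2$, and let $\mathcal J_A=\{rp : |\nu_1|\le r\le|\nu_2|\}$. There is a unique real analytic function $v:\mathbb R\to\mathbb R_{>0}$ with $$(v')^2=-v^4+4(|a|^2+|b|^2+c^2)v^2-16|ab|^2,\qquad v(0)=2|b|,$$ that is non-constant unless $|a|=|b|$ and $c=0$, and for which $v'(0)$ has the sign of $-c$ if $c\neq0$. It is the restriction to $\mathbb R$ of an elliptic function on $\mathbb C$ (a meromorphic function, constant if $|a|=|b|$ and $c=0$) that has a real and a purely imaginary period. Let $\rho>0$ be any period of $v$, and for $\lambda\in\mathbb C^*\setminus\mathcal J_A$ let $\sigma$ be the elliptic integral of the third kind $$\sigma(\lambda)=\int_0^\rho\frac{2\,dt}{1+(4\overline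 a\,\overline b\,\lambda)^{-1}v(t)^2}.$$ A $1$-Iwasawa factorization of a map $\Phi:\mathbb S^1\to \mathrm{SL}_2(\mathbb C)$ is a factorization $\Phi=FB$ in which $F,B:\mathbb S^1\to\mathrm{SL}_2(\mathbb C)$ are analytic, $F$ takes values in $\mathrm{SU}_2$, and $B$ is the boundary value of a holomorphic map from the unit disk to $\mathrm{SL}_2(\mathbb C)$ whose value at $0$ is upper triangular with positive real diagonal. Then there is a map $R:\mathbb R\times(\mathbb C\setminus\mathcal J_A)\to\mathrm{SL}_2(\mathbb C)$, real analytic in $(x,\lambda)$ and holomorphic in $\lambda$, with $R(x+\rho,\lambda)=R(x,\lambda)$, such that for all $x,y\in\mathbb R$ the loop $\Phi=\exp((x+iy)A)|_{\mathbb S^1}$ has a unique $1$-Iwasawa factorization $\Phi=\mathrm{Uni}(\Phi)\,\mathrm{Pos}(\Phi)$; the factor $\mathrm{Uni}(\Phi)$ extends holomorphically to $\mathbb C^*$, the factor $\mathrm{Pos}(\Phi)$ extends holomorphically to $\mathbb C$, and for all $\lambda\in\mathbb C^*\setminus\mathcal J_A$ these extensions are $$\mathrm{Uni}(\Phi)=\exp\big((x+iy-\rho^{-1}\sigma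 x)A\big)R,\qquad \mathrm{Pos}(\Phi)=R^{-1}\exp\big(\rho^{-1}\sigma xA\big).$$ -/

import Mathlib

open Complex ComplexConjugate Matrix

/-- Complex `2 × 2` matrices. -/
abbrev Mat2 := Matrix (Fin 2) (Fin 2) ℂ

namespace Delaunay

noncomputable section

/-! ### Loops on the unit circle and the `1`-Iwasawa factorization -/

/-- An analytic map from the unit circle to `SL(2, ℂ)`: analyticity along the circle means that the
loop is the restriction of a map that is holomorphic near the circle. -/
structure IsLoop (X : Circle → Mat2) : Prop where
  det_eq_one : ∀ z, (X z).det = 1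
  analytic : ∃ Y : ℂ → Mat2,
    (∀ i j, AnalyticOnNhd ℂ (fun l => Y l i j) (Metric.sphere 0 1)) ∧ ∀ z : Circle, Y z = X z

/-- Unitary loops: `X^* = X⁻¹`, where `X^*(l)` is the conjugate transpose of `X (1 / conj l)`,
and `1 / conj l = l` on the unit circle. -/
structure IsUnitaryLoop (X : Circle → Mat2) : Prop where
  isLoop : IsLoop X
  star_eq_inv : ∀ z, (X z)ᴴ = (X z)⁻¹

/-- Upper triangular matrices of determinant one with positive real diagonal. -/
def IsPosUpperTriangular (M : Mat2) : Prop :=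
  M.det = 1 ∧ M 1 0 = 0 ∧ ∀ i, (M i i).im = 0 ∧ 0 < (M i i).re

/-- Positive loops: boundary values of holomorphic maps from the open unit disk to `SL(2, ℂ)`
whose value at `0` is upper triangular with positive real diagonal. -/
structure IsPositiveLoop (X : Circle → Mat2) : Prop where
  isLoop : IsLoop X
  extends_disk : ∃ Y : ℂ → Mat2,
    (∀ i j, DiffContOnCl ℂ (fun l => Y l i j) (Metric.ball 0 1)) ∧
    (∀ l ∈ Metric.ball (0 : ℂ) 1, (Y l).det = 1) ∧
    (∀ z : Circle, Y z = X z) ∧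
    IsPosUpperTriangular (Y 0)

/-- `Φ = F B` with `F` a unitary and `B` a positive loop. -/
structure IsIwasawa (Φ F B : Circle → Mat2) : Prop where
  unitary : IsUnitaryLoop F
  positive : IsPositiveLoop B
  eq_mul : ∀ z, Φ z = F z * B z

/-- `Φ = F B` is the unique `1`-Iwasawa factorization of `Φ`: `F` is the `1`-unitary factor
of `Φ` and `B` is its `1`-positive factor. -/
def IsTheIwasawa (Φ F B : Circle → Mat2) : Prop :=
  IsIwasawa Φ F B ∧ ∀ F' B', IsIwasawa Φ F' B' → F' = F ∧ B' = B

/-! ### The Delaunay residue -/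

/-- The Delaunay residue with coefficients `a`, `b`, `c`, as a function of `l ≠ 0`. -/
def residue (a b : ℂ) (c : ℝ) (l : ℂ) : Mat2 :=
  !![(c : ℂ), a * l⁻¹ + conj b; b + conj a * l, -(c : ℂ)]

/-- The zeros of the determinant of the Delaunay residue. -/
def zeros (a b : ℂ) (c : ℝ) : Set ℂ :=
  {l | l ≠ 0 ∧ (residue a b c l).det = 0}

/-- The set `J_A = {r p : |ν₁| ≤ r ≤ |ν₂|}`, where `ν₁, ν₂` are the zeros of `det A`, with
`|ν₁| ≤ |ν₂|`, and `p` is the point of the unit circle on the segment from `ν₁` to `ν₂`. -/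
def cut (a b : ℂ) (c : ℝ) : Set ℂ :=
  {l | ∃ (ν₁ ν₂ p : ℂ) (r : ℝ), zeros a b c = {ν₁, ν₂} ∧ ‖ν₁‖ ≤ ‖ν₂‖ ∧
    ‖p‖ = 1 ∧ p ∈ segment ℝ ν₁ ν₂ ∧ ‖ν₁‖ ≤ r ∧ r ≤ ‖ν₂‖ ∧ l = r * p}

/-! ### The functions `v`, `ψ`, `σ` -/

/-- The vacuum case. -/
def IsVacuum (a b : ℂ) (c : ℝ) : Prop := ‖a‖ = ‖b‖ ∧ c = 0

/-- The function `v`: the positive real analytic solution of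
`(v')² = -v⁴ + 4(|a|² + |b|² + c²) v² - 16 |ab|²`, `v(0) = 2|b|`,
non-constant except in the vacuum case, with `v'(0)` of the same sign as `-c` if `c ≠ 0`. -/
structure IsProfile (a b : ℂ) (c : ℝ) (v : ℝ → ℝ) : Prop where
  pos : ∀ x, 0 < v x
  analytic : AnalyticOnNhd ℝ v Set.univ
  ode : ∀ x, (deriv v x) ^ 2 =
    -(v x) ^ 4 + 4 * (‖a‖ ^ 2 + ‖b‖ ^ 2 + c ^ 2) * (v x) ^ 2 - 16 * ‖a * b‖ ^ 2
  initial : v 0 = 2 * ‖b‖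
  nonconstant : ¬ IsVacuum a b c → ∃ x, v x ≠ v 0
  sign_deriv : c ≠ 0 → SignType.sign (deriv v 0) = SignType.sign (-c)

/-- `v` is the restriction to the real line of an elliptic function on `ℂ`
that has a real period and a purely imaginary period. -/
def IsRestrictionOfElliptic (v : ℝ → ℝ) : Prop :=
  ∃ (V : ℂ → ℂ) (ω₁ ω₂ : ℝ), (∀ z, MeromorphicAt V z) ∧ 0 < ω₁ ∧ 0 < ω₂ ∧
    (∀ z, V (z + ω₁) = V z) ∧ (∀ z, V (z + ω₂ * I) = V z) ∧ ∀ x : ℝ, V x = v x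

/-- The elliptic integral of the third kind `ψ(x, l)`, for `l ≠ 0` outside the cut. -/
def psi (a b : ℂ) (v : ℝ → ℝ) (x : ℝ) (l : ℂ) : ℂ :=
  ∫ t in (0 : ℝ)..x, 2 / (1 + (4 * conj a * conj b * l)⁻¹ * ((v t : ℂ)) ^ 2)

/-- `σ = ψ(ρ, ·)`. -/
def sigma (a b : ℂ) (v : ℝ → ℝ) (ρ : ℝ) (l : ℂ) : ℂ := psi a b v ρ l

end

end Delaunay

/-! On the unit circle `A` is Hermitian, so `exp(iyA)` is unitary and commutes with `exp(xA)`. Hence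
the positive factor `B` depends on `x` only. It is built from a Lax pair. Conjugating `A` by `B`
gives a matrix `L` of the same shape, with coefficients `a / m`, `b * m`, `k`, where `m = v /
(2|b|)` and `k = -v' / (2v)`. If `B' = P B`, where `P` (`posPart`) is the part of `L` without
negative powers of `λ`, chosen so that `L - P` is skew-Hermitian on the circle, then `U = exp(xA)
B⁻¹` satisfies `U' = U (L - P)` and stays unitary. Since `P` is affine in `λ`, `B` is entire in `λ`,
and `P` is upper triangular at `0`, which gives the normalization there
(`IsLaxFlow.exists_isPosSolution`, `IsPosSolution.exp_mul_adjugate_unitary`).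

The factorization is unique because the quotient of two positive factors is unitary on the circle
and holomorphic in the disk. Its trace is at most `2` in modulus on the circle and has real part at
least `2` at `0`, so the maximum principle makes it the identity (`IsIwasawa.unique`).

For the explicit formulas, let `ψ(x)` be the integral defining `σ`, taken from `0` to `x`. An upper
triangular gauge `G`, algebraic in `v`, `v'`, `λ` up to one square root, satisfies `G' = ψ' A G - G
P`. So `exp(-ψA) G` solves the equation of `B⁻¹` with the same initial value
(`exp_mul_gauge_eq_adjugate`). Put `R = exp((ρ⁻¹σx - ψ)A) G`. It is periodic because `ψ` grows by
`σ` over a period. It is holomorphic at `λ = 0` because `ψ / λ` and `λA` are. Off the cut no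
denominator vanishes and the square root has a branch, because `v²` stays between the two roots of
the quartic and these correspond to the ends of the cut (`IsTurning.mem_cut`).

The profile `v` is a Jacobi function of type `dn`. Its complex extension is written down by the
addition theorem and checked by the Cauchy-Riemann equations. Uniqueness of `v` uses the second
order equation, since the first order one is degenerate at turning points. -/

namespace Delaunay

section

/-! ### Jacobi elliptic functions of a real variable -/

/-- The flow of a positive, bounded, periodic vector field on the line is defined for all times and
commutes with the period up to a time shift. -/
theorem exists_flow_of_periodic {g : ℝ → ℝ} {M P : ℝ} (hg : Continuous g) (hpos : ∀ x, 0 < g x)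
    (hM : ∀ x, g x ≤ M) (hP : 0 < P) (hper : Function.Periodic g P) (x₀ : ℝ) :
    ∃ φ : ℝ → ℝ, φ 0 = x₀ ∧ (∀ x, HasDerivAt φ (g (φ x)) x) ∧
      ∃ T, 0 < T ∧ ∀ x, φ (x + T) = φ x + P := by
  have hM0 : 0 < M := (hpos 0).trans_le (hM 0)
  have hgi : Continuous fun x => (g x)⁻¹ := hg.inv₀ fun x => (hpos x).ne'
  -- `F θ` is the time needed to travel from `x₀` to `θ`; the flow is its inverse function.
  set F : ℝ → ℝ := fun θ => ∫ t in x₀..θ, (g t)⁻¹ with hF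
  have hFd : ∀ θ, HasDerivAt F (g θ)⁻¹ θ := fun θ =>
    intervalIntegral.integral_hasDerivAt_right (hgi.intervalIntegrable _ _)
      (hgi.stronglyMeasurableAtFilter _ _) hgi.continuousAt
  have hFc : Continuous F := continuous_iff_continuousAt.2 fun θ => (hFd θ).continuousAt
  have hmono : StrictMono F := strictMono_of_deriv_pos fun θ => by
    rw [(hFd θ).deriv]; exact inv_pos.2 (hpos θ)
  -- The bound `g ≤ M` makes the travel time grow at least linearly, so `F` is onto and the flow
  -- never blows up.
  have hgrow : Monotone fun θ => F θ - θ / M := by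
    apply monotone_of_deriv_nonneg
    · exact fun θ => ((hFd θ).sub ((hasDerivAt_id θ).div_const M)).differentiableAt
    · intro θ
      have h := ((hFd θ).sub ((hasDerivAt_id θ).div_const M)).deriv
      have h' : deriv (fun θ => F θ - θ / M) θ = (g θ)⁻¹ - 1 / M := h
      rw [h', sub_nonneg, one_div]
      exact inv_anti₀ (hpos θ) (hM θ)
  have hF0 : F x₀ = 0 := by simp [hF]
  have hsurj : Function.Surjective F := by
    apply hFc.surjective
    · have h1 : Filter.Tendsto (fun θ => (F x₀ - x₀ / M) + θ / M) Filter.atTop Filter.atTop :=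
        Filter.tendsto_atTop_add_const_left _ _ (Filter.tendsto_id.atTop_div_const hM0)
      refine Filter.tendsto_atTop_mono' _ ?_ h1
      filter_upwards [Filter.eventually_ge_atTop x₀] with θ hθ
      have := hgrow hθ
      simp only at this
      linarith
    · have h1 : Filter.Tendsto (fun θ => (F x₀ - x₀ / M) + θ / M) Filter.atBot Filter.atBot :=
        Filter.tendsto_atBot_add_const_left _ _ (Filter.tendsto_id.atBot_div_const hM0)
      refine Filter.tendsto_atBot_mono' _ ?_ h1
      filter_upwards [Filter.eventually_le_atBot x₀] with θ hθ
      have := hgrow hθ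
      simp only at this
      linarith
  set e := hmono.orderIsoOfSurjective F hsurj with he
  have heF : ∀ θ, e θ = F θ := fun θ => rfl
  have hFe : ∀ x, F (e.symm x) = x := fun x => e.apply_symm_apply x
  have hPF : ∀ θ, F (θ + P) = F θ + F (x₀ + P) := by
    intro θ
    have h1 : ∫ t in θ..θ + P, (g t)⁻¹ = ∫ t in x₀..x₀ + P, (g t)⁻¹ :=
      Function.Periodic.intervalIntegral_add_eq (hper.comp _) θ x₀
    have h2 := intervalIntegral.integral_add_adjacent_intervals (a := x₀) (b := θ) (c := θ + P)
      (hgi.intervalIntegrable (μ := MeasureTheory.volume) _ _) (hgi.intervalIntegrable _ _)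
    simp only [hF]
    rw [← h1, h2]
  refine ⟨e.symm, ?_, fun x => ?_, F (x₀ + P), ?_, fun x => ?_⟩
  · rw [e.symm_apply_eq, heF, hF0]
  · have h := HasDerivAt.of_local_left_inverse (f := F) (g := e.symm) (a := x)
      e.symm.continuous.continuousAt (hFd _) (inv_ne_zero (hpos _).ne')
      (Filter.Eventually.of_forall hFe)
    simpa using h
  · rw [← hF0]; exact hmono (by linarith)
  · rw [e.symm_apply_eq, heF, hPF (e.symm x), hFe]

/-- The functions `s`, `c`, `d` are, up to a common affine change of variable, the Jacobi functions
`sn`, `cn` and a multiple of `dn`; the values of `d ^ 2` lie between `α ^ 2` and `γ ^ 2`. -/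
structure IsJacobi (α γ T : ℝ) (s c d : ℝ → ℝ) : Prop where
  sq_add_sq : ∀ x, s x ^ 2 + c x ^ 2 = 1
  d_sq : ∀ x, d x ^ 2 = α ^ 2 * c x ^ 2 + γ ^ 2 * s x ^ 2
  d_pos : ∀ x, 0 < d x
  hasDerivAt_s : ∀ x, HasDerivAt s (c x * d x) x
  hasDerivAt_c : ∀ x, HasDerivAt c (-(s x * d x)) x
  hasDerivAt_d : ∀ x, HasDerivAt d (-((α ^ 2 - γ ^ 2) * (s x * c x))) x
  period_pos : 0 < T
  periodic_s : Function.Periodic s T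
  periodic_c : Function.Periodic c T
  periodic_d : Function.Periodic d T

/-- The amplitude `φ` solves `φ' = √(α² cos² φ + γ² sin² φ)`, and `s`, `c`, `d` are `sin φ`, `cos
φ`, `φ'`. The time in which `φ` gains `2π` is a common period. -/
theorem exists_isJacobi {α γ : ℝ} (hα : 0 < α) (hγ : 0 < γ) (φ₀ : ℝ) :
    ∃ T s c d, IsJacobi α γ T s c d ∧ s 0 = Real.sin φ₀ ∧ c 0 = Real.cos φ₀ := by
  set q : ℝ → ℝ := fun θ => α ^ 2 * Real.cos θ ^ 2 + γ ^ 2 * Real.sin θ ^ 2 with hq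
  have hqpos : ∀ θ, 0 < q θ := by
    intro θ
    simp only [hq]
    rcases eq_or_ne (Real.sin θ) 0 with h | h
    · have h1 := Real.sin_sq_add_cos_sq θ
      rw [h] at h1 ⊢
      nlinarith [sq_pos_of_pos hα]
    · positivity
  have hqc : Continuous q := by fun_prop
  have hqle : ∀ θ, q θ ≤ α ^ 2 + γ ^ 2 := by
    intro θ
    simp only [hq]
    nlinarith [mul_nonneg (sq_nonneg α) (sub_nonneg.2 (Real.cos_sq_le_one θ)),
      mul_nonneg (sq_nonneg γ) (sub_nonneg.2 (Real.sin_sq_le_one θ))]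
  obtain ⟨φ, h0, hφ, T, hT, hper⟩ := exists_flow_of_periodic (g := fun θ => √(q θ))
    (M := √(α ^ 2 + γ ^ 2)) (P := 2 * Real.pi) hqc.sqrt (fun θ => Real.sqrt_pos.2 (hqpos θ))
    (fun θ => Real.sqrt_le_sqrt (hqle θ)) Real.two_pi_pos (fun θ => by simp [hq]) φ₀
  have hs : ∀ x, HasDerivAt (fun x => Real.sin (φ x)) (Real.cos (φ x) * √(q (φ x))) x :=
    fun x => (hφ x).sin
  have hc : ∀ x, HasDerivAt (fun x => Real.cos (φ x)) (-(Real.sin (φ x) * √(q (φ x)))) x :=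
    fun x => by simpa using (hφ x).cos
  refine ⟨T, fun x => Real.sin (φ x), fun x => Real.cos (φ x), fun x => √(q (φ x)),
    ⟨fun x => Real.sin_sq_add_cos_sq _, fun x => Real.sq_sqrt (hqpos _).le,
      fun x => Real.sqrt_pos.2 (hqpos _), hs, hc, fun x => ?_, hT, fun x => by simp [hper],
      fun x => by simp [hper], fun x => by simp [hper, hq]⟩, by simp [h0], by simp [h0]⟩
  · have h1 := ((((hc x).pow 2).const_mul (α ^ 2)).add (((hs x).pow 2).const_mul (γ ^ 2))).sqrt
      (hqpos (φ x)).ne'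
    refine (h1.congr_deriv ?_ :)
    have h3 : √(q (φ x)) ≠ 0 := (Real.sqrt_pos.2 (hqpos _)).ne'
    simp only [Pi.add_apply, Pi.pow_apply]
    change _ / (2 * √(q (φ x))) = _
    field_simp
    ring

end

section

/-! ### The elliptic extension of `d` -/

/-- The Cauchy-Riemann criterion for a quotient. -/
theorem differentiableAt_div_of_cauchyRiemann {N D : ℂ → ℂ} {N' D' : ℂ →L[ℝ] ℂ} {z : ℂ}
    (hN : HasFDerivAt N N' z) (hD : HasFDerivAt D D' z) (hz : D z ≠ 0)
    (h : N' I * D z - N z * D' I = I * (N' 1 * D z - N z * D' 1)) :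
    DifferentiableAt ℂ (fun w => N w / D w) z := by
  have hq : HasFDerivAt (fun w => N w / D w) _ z :=
    (hN.mul ((hasDerivAt_inv hz).comp_hasFDerivAt_of_eq (𝕜 := ℝ) z hD rfl)).congr_of_eventuallyEq
      (Filter.Eventually.of_forall fun w => div_eq_mul_inv _ _)
  refine differentiableAt_complex_iff_differentiableAt_real.2 ⟨hq.differentiableAt, ?_⟩
  rw [hq.fderiv]
  simp only [Function.comp_apply, _root_.add_apply, _root_.smul_apply,
    smul_eq_mul]
  field_simp
  linear_combination h

variable {α β γ T T₁ : ℝ} {s c d s₁ c₁ d₁ : ℝ → ℝ}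

/-- The numerator in the addition theorem. -/
noncomputable def ellipticNum (α γ : ℝ) (s c d s₁ c₁ d₁ : ℝ → ℝ) (z : ℂ) : ℂ :=
  α * (d z.re * (c₁ z.im * d₁ z.im)) - I * (α * γ ^ 2 * ((s z.re * c z.re) * s₁ z.im))

/-- The denominator in the addition theorem. -/
noncomputable def ellipticDen (α γ : ℝ) (s s₁ c₁ : ℝ → ℝ) (z : ℂ) : ℂ :=
  α ^ 2 * c₁ z.im ^ 2 + γ ^ 2 * (s z.re ^ 2 * s₁ z.im ^ 2)

theorem hasFDerivAt_comp_re {f : ℝ → ℝ} {f' : ℝ} {z : ℂ} (h : HasDerivAt f f' z.re) :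
    HasFDerivAt (fun w : ℂ => (f w.re : ℂ)) (ofRealCLM.comp (f' • reCLM)) z :=
  ofRealCLM.hasFDerivAt.comp z (h.comp_hasFDerivAt z reCLM.hasFDerivAt)

theorem hasFDerivAt_comp_im {f : ℝ → ℝ} {f' : ℝ} {z : ℂ} (h : HasDerivAt f f' z.im) :
    HasFDerivAt (fun w : ℂ => (f w.im : ℂ)) (ofRealCLM.comp (f' • imCLM)) z :=
  ofRealCLM.hasFDerivAt.comp z (h.comp_hasFDerivAt z imCLM.hasFDerivAt)

/-- The quotient is the addition formula for `dn(x + iy)`, with the values at `iy` rewritten through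
functions of the complementary modulus; `hsq` expresses this complementarity. The Cauchy-Riemann
equation then becomes a polynomial identity modulo the quadratic relations. -/
theorem differentiableAt_elliptic (hj : IsJacobi α β T s c d) (hj₁ : IsJacobi α γ T₁ s₁ c₁ d₁)
    (hsq : α ^ 2 = β ^ 2 + γ ^ 2) {z : ℂ} (hz : ellipticDen α γ s s₁ c₁ z ≠ 0) :
    DifferentiableAt ℂ
      (fun w => ellipticNum α γ s c d s₁ c₁ d₁ w / ellipticDen α γ s s₁ c₁ w) z := by
  have es := hasFDerivAt_comp_re (hj.hasDerivAt_s z.re)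
  have ec := hasFDerivAt_comp_re (hj.hasDerivAt_c z.re)
  have ed := hasFDerivAt_comp_re (hj.hasDerivAt_d z.re)
  have es₁ := hasFDerivAt_comp_im (hj₁.hasDerivAt_s z.im)
  have ec₁ := hasFDerivAt_comp_im (hj₁.hasDerivAt_c z.im)
  have ed₁ := hasFDerivAt_comp_im (hj₁.hasDerivAt_d z.im)
  have hN := ((ed.mul (ec₁.mul ed₁)).const_mul (α : ℂ)).sub
    ((((es.mul ec).mul es₁).const_mul (α * γ ^ 2 : ℂ)).const_mul I)
  have hD := ((ec₁.pow 2).const_mul (α ^ 2 : ℂ)).add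
    (((es.pow 2).mul (es₁.pow 2)).const_mul (γ ^ 2 : ℂ))
  refine differentiableAt_div_of_cauchyRiemann (N := ellipticNum α γ s c d s₁ c₁ d₁)
    (D := ellipticDen α γ s s₁ c₁) hN hD hz ?_
  have e1 : (s z.re : ℂ) ^ 2 + c z.re ^ 2 = 1 := by exact_mod_cast hj.sq_add_sq z.re
  have e2 : (s₁ z.im : ℂ) ^ 2 + c₁ z.im ^ 2 = 1 := by exact_mod_cast hj₁.sq_add_sq z.im
  have e3 : (d z.re : ℂ) ^ 2 = α ^ 2 * c z.re ^ 2 + β ^ 2 * s z.re ^ 2 := by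
    exact_mod_cast hj.d_sq z.re
  have e4 : (d₁ z.im : ℂ) ^ 2 = α ^ 2 * c₁ z.im ^ 2 + γ ^ 2 * s₁ z.im ^ 2 := by
    exact_mod_cast hj₁.d_sq z.im
  have e5 : (α : ℂ) ^ 2 = β ^ 2 + γ ^ 2 := by exact_mod_cast hsq
  simp [ellipticNum, ellipticDen]
  generalize (s z.re : ℂ) = S at *
  generalize (c z.re : ℂ) = C at *
  generalize (d z.re : ℂ) = D at *
  generalize (s₁ z.im : ℂ) = S1 at *
  generalize (c₁ z.im : ℂ) = C1 at *
  generalize (d₁ z.im : ℂ) = D1 at *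
  have h1 : C ^ 2 = 1 - S ^ 2 := by linear_combination e1
  have h2 : C1 ^ 2 = 1 - S1 ^ 2 := by linear_combination e2
  have h4 : D1 ^ 2 = α ^ 2 - (α ^ 2 - γ ^ 2) * S1 ^ 2 := by rw [e4, h2]; ring
  have h3 : D ^ 2 = α ^ 2 - γ ^ 2 * S ^ 2 := by
    rw [e3, h1]; linear_combination -S ^ 2 * e5
  have h5 : (α : ℂ) ^ 2 - β ^ 2 = γ ^ 2 := by linear_combination e5
  -- The real part of the Cauchy-Riemann equation is `α * D * S1` times this identity; the imaginary
  -- part reduces to `h3`.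
  have hr : -((α ^ 2 - γ ^ 2) * C1 ^ 2 + D1 ^ 2) * (α ^ 2 * C1 ^ 2 + γ ^ 2 * (S ^ 2 * S1 ^ 2)) +
      2 * C1 ^ 2 * D1 ^ 2 * (α ^ 2 - γ ^ 2 * S ^ 2) =
      γ ^ 2 * (C ^ 2 - S ^ 2) * (α ^ 2 * C1 ^ 2 + γ ^ 2 * (S ^ 2 * S1 ^ 2)) -
      2 * γ ^ 4 * S ^ 2 * C ^ 2 * S1 ^ 2 := by
    rw [h1, h2, h4]; ring
  rw [h5]
  linear_combination (α * D * S1) * hr +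
    (I * α * γ ^ 2 * S * C * C1 * D1 * 2 * S1 ^ 2) * h3 +
    (α * γ ^ 2 * S1 * D * (C ^ 2 - S ^ 2) * (α ^ 2 * C1 ^ 2 + γ ^ 2 * (S ^ 2 * S1 ^ 2)) -
      α * γ ^ 2 * S * C * S1 * (γ ^ 2 * (S1 ^ 2 * (2 * S * (C * D))))) * I_sq

theorem IsJacobi.continuous_s (hj : IsJacobi α γ T s c d) : Continuous s :=
  continuous_iff_continuousAt.2 fun x => (hj.hasDerivAt_s x).continuousAt

theorem IsJacobi.continuous_c (hj : IsJacobi α γ T s c d) : Continuous c :=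
  continuous_iff_continuousAt.2 fun x => (hj.hasDerivAt_c x).continuousAt

theorem IsJacobi.continuous_d (hj : IsJacobi α γ T s c d) : Continuous d :=
  continuous_iff_continuousAt.2 fun x => (hj.hasDerivAt_d x).continuousAt

/-- A function with a simple zero is bounded below by a multiple of the distance to the zero. -/
theorem exists_sq_le_of_hasDerivAt {f : ℝ → ℝ} {f' x₀ : ℝ} (hf : HasDerivAt f f' x₀)
    (hf' : f' ≠ 0) (h0 : f x₀ = 0) :
    ∃ C : ℝ, 0 < C ∧ ∀ᶠ x in nhds x₀, (x - x₀) ^ 2 ≤ C * f x ^ 2 := by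
  have h1 : ∀ᶠ x in nhds x₀, ‖x - x₀‖ ≤ 2 * ‖f'‖⁻¹ * ‖f x‖ := by
    have h2 := hf.isLittleO.def (c := ‖f'‖ / 2) (by positivity)
    filter_upwards [h2] with x hx
    rw [h0, sub_zero, smul_eq_mul] at hx
    have h3 : ‖(x - x₀) * f'‖ ≤ ‖f x‖ + ‖f x - (x - x₀) * f'‖ := by
      have := norm_sub_le (f x) (f x - (x - x₀) * f')
      simpa using this
    rw [norm_mul] at h3
    have h4 : 0 < ‖f'‖ := norm_pos_iff.2 hf'
    rw [mul_assoc, inv_mul_eq_div, ← mul_div_assoc, le_div_iff₀ h4]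
    nlinarith
  refine ⟨(2 * ‖f'‖⁻¹) ^ 2, by positivity, ?_⟩
  filter_upwards [h1] with x hx
  have := pow_le_pow_left₀ (norm_nonneg _) hx 2
  rw [mul_pow] at this
  simpa using this

/-- The denominator is a sum of two squares, so at a zero both `c₁` and `s` vanish, and these zeros
are simple. The denominator is therefore bounded below by a multiple of `‖w - z‖²`, and the
singularity is at worst a pole. -/
theorem meromorphicAt_elliptic (hα : 0 < α) (hγ : 0 < γ) (hj : IsJacobi α β T s c d)
    (hj₁ : IsJacobi α γ T₁ s₁ c₁ d₁) (hsq : α ^ 2 = β ^ 2 + γ ^ 2) (z : ℂ) :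
    MeromorphicAt
      (fun w => ellipticNum α γ s c d s₁ c₁ d₁ w / ellipticDen α γ s s₁ c₁ w) z := by
  have hsc := hj.continuous_s
  have hcc := hj.continuous_c
  have hdc := hj.continuous_d
  have hsc₁ := hj₁.continuous_s
  have hcc₁ := hj₁.continuous_c
  have hdc₁ := hj₁.continuous_d
  have hNc : Continuous (ellipticNum α γ s c d s₁ c₁ d₁) := by
    unfold ellipticNum; fun_prop
  have hDc : Continuous (ellipticDen α γ s s₁ c₁) := by
    unfold ellipticDen; fun_prop
  by_cases hz : ellipticDen α γ s s₁ c₁ z = 0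
  · have hDr : ∀ w, ellipticDen α γ s s₁ c₁ w =
        ((α ^ 2 * c₁ w.im ^ 2 + γ ^ 2 * (s w.re ^ 2 * s₁ w.im ^ 2) : ℝ) : ℂ) := by
      intro w; simp [ellipticDen]
    rw [hDr, ofReal_eq_zero] at hz
    have hc0 : c₁ z.im = 0 := by
      have : α ^ 2 * c₁ z.im ^ 2 = 0 := by
        have h1 : 0 ≤ γ ^ 2 * (s z.re ^ 2 * s₁ z.im ^ 2) := by positivity
        have h2 : 0 ≤ α ^ 2 * c₁ z.im ^ 2 := by positivity
        linarith
      simpa [hα.ne'] using this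
    have hs1 : s₁ z.im ^ 2 = 1 := by simpa [hc0] using hj₁.sq_add_sq z.im
    have hs0 : s z.re = 0 := by simpa [hc0, hs1, hγ.ne'] using hz
    have hc1 : c z.re ^ 2 = 1 := by simpa [hs0] using hj.sq_add_sq z.re
    obtain ⟨C, hC, hCs⟩ := exists_sq_le_of_hasDerivAt (hj.hasDerivAt_s z.re)
      (mul_ne_zero (fun h => by simp [h] at hc1) (hj.d_pos _).ne') hs0
    obtain ⟨C₁, hC₁, hCs₁⟩ := exists_sq_le_of_hasDerivAt (hj₁.hasDerivAt_c z.im)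
      (neg_ne_zero.2 (mul_ne_zero (fun h => by simp [h] at hs1) (hj₁.d_pos _).ne')) hc0
    have hlow : ∀ᶠ y in nhds z.im, 1 / 2 < s₁ y ^ 2 := by
      refine (hsc₁.pow 2).continuousAt.eventually_const_lt ?_
      rw [Pi.pow_apply, hs1]; norm_num
    have hbd : ∃ M : ℝ, 0 < M ∧ ∀ᶠ w in nhds z,
        ‖w - z‖ ^ 2 ≤ M * (α ^ 2 * c₁ w.im ^ 2 + γ ^ 2 * (s w.re ^ 2 * s₁ w.im ^ 2)) := by
      refine ⟨C₁ / α ^ 2 + 2 * C / γ ^ 2, by positivity, ?_⟩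
      filter_upwards [continuous_re.continuousAt.eventually hCs,
        continuous_im.continuousAt.eventually hCs₁, continuous_im.continuousAt.eventually hlow]
        with w h1 h2 h3
      have e : ‖w - z‖ ^ 2 = (w.re - z.re) ^ 2 + (w.im - z.im) ^ 2 := by
        rw [← normSq_eq_norm_sq, normSq_apply]; simp; ring
      have hu : 0 ≤ α ^ 2 * c₁ w.im ^ 2 := by positivity
      have hv : 0 ≤ γ ^ 2 * (s w.re ^ 2 * s₁ w.im ^ 2) := by positivity
      have h4 : (w.im - z.im) ^ 2 ≤ C₁ / α ^ 2 * (α ^ 2 * c₁ w.im ^ 2) := by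
        refine h2.trans (le_of_eq ?_); field_simp
      have h5 : (w.re - z.re) ^ 2 ≤ 2 * C / γ ^ 2 * (γ ^ 2 * (s w.re ^ 2 * s₁ w.im ^ 2)) := by
        have : 2 * C / γ ^ 2 * (γ ^ 2 * (s w.re ^ 2 * s₁ w.im ^ 2)) =
          C * s w.re ^ 2 * (2 * s₁ w.im ^ 2) := by field_simp
        rw [this]
        refine h1.trans (le_mul_of_one_le_right (by positivity) (by linarith))
      rw [e, add_mul, mul_add, mul_add]
      have : 0 ≤ C₁ / α ^ 2 * (γ ^ 2 * (s w.re ^ 2 * s₁ w.im ^ 2)) := by positivity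
      have : 0 ≤ 2 * C / γ ^ 2 * (α ^ 2 * c₁ w.im ^ 2) := by positivity
      linarith
    obtain ⟨M, hM, hbd⟩ := hbd
    -- The square of `w - z` bounds the quotient; the third power makes the product tend to `0`,
    -- which is its value at `z`, as removability requires.
    refine ⟨3, analyticAt_of_differentiable_on_punctured_nhds_of_continuousAt ?_ ?_⟩
    · filter_upwards [hbd.filter_mono nhdsWithin_le_nhds, self_mem_nhdsWithin] with w h1 h2
      refine DifferentiableAt.fun_smul (c := fun w => (w - z) ^ 3) (by fun_prop)
        (differentiableAt_elliptic hj hj₁ hsq fun h => ?_)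
      rw [hDr, ofReal_eq_zero] at h
      rw [h, mul_zero] at h1
      have : ‖w - z‖ = 0 := by
        have := norm_nonneg (w - z); nlinarith
      exact h2 (sub_eq_zero.1 (norm_eq_zero.1 this))
    · have hlim : Filter.Tendsto
          (fun w => M * (‖w - z‖ * ‖ellipticNum α γ s c d s₁ c₁ d₁ w‖)) (nhds z) (nhds 0) := by
        have : Continuous fun w => M * (‖w - z‖ * ‖ellipticNum α γ s c d s₁ c₁ d₁ w‖) := by
          fun_prop
        simpa using this.tendsto z
      rw [ContinuousAt]
      simp only [sub_self, smul_eq_mul]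
      rw [show (0 : ℂ) ^ 3 * _ = 0 by simp]
      refine squeeze_zero_norm' ?_ hlim
      filter_upwards [hbd] with w hw
      rw [hDr, norm_mul, norm_div, norm_pow, norm_real]
      set Δ := α ^ 2 * c₁ w.im ^ 2 + γ ^ 2 * (s w.re ^ 2 * s₁ w.im ^ 2) with hΔ
      have hΔ0 : 0 ≤ Δ := by positivity
      rw [Real.norm_of_nonneg hΔ0]
      rcases hΔ0.eq_or_lt with h | h
      · rw [← h]; simp; positivity
      · rw [← mul_div_assoc, div_le_iff₀ h]
        calc ‖w - z‖ ^ 3 * ‖ellipticNum α γ s c d s₁ c₁ d₁ w‖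
            = ‖w - z‖ ^ 2 * (‖w - z‖ * ‖ellipticNum α γ s c d s₁ c₁ d₁ w‖) := by ring
          _ ≤ (M * Δ) * (‖w - z‖ * ‖ellipticNum α γ s c d s₁ c₁ d₁ w‖) := by gcongr
          _ = _ := by ring
  · refine AnalyticAt.meromorphicAt ?_
    refine analyticAt_of_differentiable_on_punctured_nhds_of_continuousAt ?_
      (differentiableAt_elliptic hj hj₁ hsq hz).continuousAt
    filter_upwards [(hDc.continuousAt.eventually_ne hz).filter_mono nhdsWithin_le_nhds] with w hw
    exact differentiableAt_elliptic hj hj₁ hsq hw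

end

section

/-! ### Existence and uniqueness of the profile -/

/-- The turning values `β ≤ α` of the profile. -/
structure IsTurning (a b : ℂ) (c α β : ℝ) : Prop where
  pos : 0 < β
  le : β ≤ α
  sq_add_sq : α ^ 2 + β ^ 2 = 4 * (‖a‖ ^ 2 + ‖b‖ ^ 2 + c ^ 2)
  mul_eq : α * β = 4 * ‖a * b‖
  isVacuum_iff : IsVacuum a b c ↔ β = α

variable {a b : ℂ} {c α β : ℝ} {v w : ℝ → ℝ}

theorem exists_isTurning (ha : a ≠ 0) (hb : b ≠ 0) (c : ℝ) : ∃ α β, IsTurning a b c α β := by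
  have ha' : 0 < ‖a‖ := norm_pos_iff.2 ha
  have hb' : 0 < ‖b‖ := norm_pos_iff.2 hb
  set K := ‖a‖ ^ 2 + ‖b‖ ^ 2 + c ^ 2 with hK
  have hdiff : K - 2 * ‖a * b‖ = (‖a‖ - ‖b‖) ^ 2 + c ^ 2 := by rw [norm_mul]; ring
  have h1 : 0 ≤ K - 2 * ‖a * b‖ := by rw [hdiff]; positivity
  have h2 : 0 ≤ K + 2 * ‖a * b‖ := by positivity
  have hab : 0 < ‖a * b‖ := by rw [norm_mul]; positivity
  -- These solve `(α ± β)² = 4 (K ± 2|ab|)`. By `hdiff` the two values coincide exactly in the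
  -- vacuum case.
  refine ⟨√(K + 2 * ‖a * b‖) + √(K - 2 * ‖a * b‖), √(K + 2 * ‖a * b‖) - √(K - 2 * ‖a * b‖),
    ?_, ?_, ?_, ?_, ?_⟩
  · exact sub_pos.2 (Real.sqrt_lt_sqrt h1 (by linarith))
  · linarith [Real.sqrt_nonneg (K - 2 * ‖a * b‖)]
  · linear_combination 2 * Real.sq_sqrt h1 + 2 * Real.sq_sqrt h2
  · linear_combination Real.sq_sqrt h2 - Real.sq_sqrt h1
  · have h3 : √(K + 2 * ‖a * b‖) - √(K - 2 * ‖a * b‖) = √(K + 2 * ‖a * b‖) + √(K - 2 * ‖a * b‖) ↔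
        K - 2 * ‖a * b‖ = 0 := by
      rw [← Real.sqrt_eq_zero h1]
      constructor <;> intro h <;> linarith
    rw [h3, hdiff, IsVacuum]
    constructor
    · rintro ⟨h4, h5⟩; simp [h4, h5]
    · intro h
      have h4 : (‖a‖ - ‖b‖) ^ 2 = 0 := by nlinarith [sq_nonneg (‖a‖ - ‖b‖), sq_nonneg c]
      have h5 : c ^ 2 = 0 := by nlinarith [sq_nonneg (‖a‖ - ‖b‖), sq_nonneg c]
      exact ⟨by nlinarith [pow_eq_zero_iff (two_ne_zero) |>.1 h4], by simpa using h5⟩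

theorem IsTurning.quartic (ht : IsTurning a b c α β) (u : ℝ) :
    -u ^ 4 + 4 * (‖a‖ ^ 2 + ‖b‖ ^ 2 + c ^ 2) * u ^ 2 - 16 * ‖a * b‖ ^ 2 =
      (α ^ 2 - u ^ 2) * (u ^ 2 - β ^ 2) := by
  linear_combination (-u ^ 2) * ht.sq_add_sq + (α * β + 4 * ‖a * b‖) * ht.mul_eq

/-- The right side is a square, so `2|b|` lies between the turning values and is an admissible
initial value. -/
theorem IsTurning.quartic_initial (ht : IsTurning a b c α β) :
    (α ^ 2 - (2 * ‖b‖) ^ 2) * ((2 * ‖b‖) ^ 2 - β ^ 2) = (4 * c * ‖b‖) ^ 2 := by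
  rw [← ht.quartic, norm_mul]; ring

theorem sq_mem_Icc_of_mul_nonneg {u : ℝ} (h : 0 ≤ (α ^ 2 - u ^ 2) * (u ^ 2 - β ^ 2))
    (hβ : 0 < β) (hle : β ≤ α) : β ^ 2 ≤ u ^ 2 ∧ u ^ 2 ≤ α ^ 2 := by
  have h1 : β ^ 2 ≤ α ^ 2 := by gcongr
  constructor <;> by_contra! h2 <;> nlinarith

theorem IsProfile.sq_mem_Icc (hv : IsProfile a b c v) (ht : IsTurning a b c α β) (x : ℝ) :
    β ^ 2 ≤ v x ^ 2 ∧ v x ^ 2 ≤ α ^ 2 := by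
  refine sq_mem_Icc_of_mul_nonneg ?_ ht.pos ht.le
  rw [← ht.quartic, ← hv.ode]
  positivity

theorem exists_isProfile_of_isVacuum (hb : b ≠ 0) (h : IsVacuum a b c) :
    ∃ v, IsProfile a b c v ∧ IsRestrictionOfElliptic v := by
  obtain ⟨h1, h2⟩ := h
  refine ⟨fun _ => 2 * ‖b‖, ⟨fun _ => by positivity, analyticOnNhd_const, fun x => ?_, rfl,
    fun h => absurd ⟨h1, h2⟩ h, fun h => absurd h2 h⟩, fun _ => (2 * ‖b‖ : ℝ), 1, 1,
    fun z => analyticAt_const.meromorphicAt, one_pos, one_pos, fun _ => rfl, fun _ => rfl,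
    fun _ => rfl⟩
  simp only [deriv_const, norm_mul, h1, h2]
  ring

/-- If `d` were constant, `s * c` would vanish identically. Its derivative `(c² - s²) d` would then
vanish too, forcing `s² = c² = 1/2`, a contradiction. -/
theorem IsJacobi.exists_ne {γ T : ℝ} {s c d : ℝ → ℝ} (hj : IsJacobi α γ T s c d)
    (h : γ ^ 2 ≠ α ^ 2) : ∃ x, d x ≠ d 0 := by
  by_contra! hc
  have h1 : ∀ x, s x * c x = 0 := by
    intro x
    have h2 : HasDerivAt d 0 x := by
      rw [show d = fun _ => d 0 from funext hc]; exact hasDerivAt_const _ _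
    have h3 := (hj.hasDerivAt_d x).unique h2
    rw [neg_eq_zero, mul_eq_zero] at h3
    exact h3.resolve_left fun h4 => h (by linarith)
  have h2 : HasDerivAt (fun x => s x * c x) 0 0 := by
    rw [show (fun x => s x * c x) = fun _ => 0 from funext h1]; exact hasDerivAt_const _ _
  have h3 := ((hj.hasDerivAt_s 0).mul (hj.hasDerivAt_c 0)).unique h2
  have h4 : (c 0 ^ 2 - s 0 ^ 2) * d 0 = 0 := by linear_combination h3
  have h5 := (mul_eq_zero.1 h4).resolve_right (hj.d_pos 0).ne'
  have h6 := hj.sq_add_sq 0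
  have h7 : s 0 ^ 2 = 1 / 2 := by linarith
  have h8 : c 0 ^ 2 = 1 / 2 := by linarith
  have h9 : (s 0 * c 0) ^ 2 = 1 / 4 := by rw [mul_pow, h7, h8]; norm_num
  rw [h1] at h9
  norm_num at h9

theorem exists_isProfile_of_not_isVacuum (ht : IsTurning a b c α β) (hb : b ≠ 0)
    (h : ¬ IsVacuum a b c) : ∃ v, IsProfile a b c v ∧ IsRestrictionOfElliptic v := by
  have hb' : 0 < ‖b‖ := norm_pos_iff.2 hb
  have hα : 0 < α := ht.pos.trans_le ht.le
  have hlt : β < α := lt_of_le_of_ne ht.le fun h' => h (ht.isVacuum_iff.2 h')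
  have hlt2 : β ^ 2 < α ^ 2 := by have := ht.pos; gcongr
  set γ := √(α ^ 2 - β ^ 2) with hγ
  have hγ0 : 0 < γ := Real.sqrt_pos.2 (by linarith)
  have hγ2 : γ ^ 2 = α ^ 2 - β ^ 2 := Real.sq_sqrt (by linarith)
  have hin := ht.quartic_initial
  obtain ⟨hl, hr⟩ := sq_mem_Icc_of_mul_nonneg (hin.ge.trans' (sq_nonneg _)) ht.pos ht.le
  -- `r = |sin φ₀|` is determined by `d(0)² = α² - γ² sin² φ₀ = 4|b|²`.
  set r := √((α ^ 2 - (2 * ‖b‖) ^ 2) / γ ^ 2) with hr_def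
  have hr2 : r ^ 2 = (α ^ 2 - (2 * ‖b‖) ^ 2) / γ ^ 2 :=
    Real.sq_sqrt (div_nonneg (by linarith) (by positivity))
  have hr0 : 0 ≤ r := Real.sqrt_nonneg _
  have hr1 : r ^ 2 ≤ 1 := by rw [hr2, div_le_one (by positivity)]; linarith
  have hr1' : r ≤ 1 := by nlinarith
  -- Since `d'(0) = -γ² sin φ₀ cos φ₀`, giving `sin φ₀` the sign of `c` and keeping `cos φ₀ ≥ 0`
  -- yields the prescribed sign of `v'(0)`.
  obtain ⟨φ₀, hsin, hcos⟩ : ∃ φ₀, Real.sin φ₀ = (if 0 ≤ c then r else -r) ∧ 0 ≤ Real.cos φ₀ := by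
    refine ⟨Real.arcsin (if 0 ≤ c then r else -r), Real.sin_arcsin ?_ ?_, Real.cos_arcsin_nonneg _⟩
    · split_ifs <;> linarith
    · split_ifs <;> linarith
  obtain ⟨T, s, k, d, hj, hs0, hk0⟩ := exists_isJacobi hα ht.pos φ₀
  -- The system in the imaginary direction starts at angle `0`, where `s₁ = 0`, `c₁ = 1`, `d₁ = α`,
  -- so that `V` restricts to `d` on the real line.
  obtain ⟨T₁, s₁, c₁, d₁, hj₁, hs₁, hc₁⟩ := exists_isJacobi hα hγ0 0
  rw [Real.sin_zero] at hs₁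
  rw [Real.cos_zero] at hc₁
  have hd₁ : d₁ 0 = α := by
    have := hj₁.d_sq 0
    rw [hs₁, hc₁] at this
    exact (sq_eq_sq₀ (hj₁.d_pos 0).le hα.le).1 (by linarith)
  set V : ℂ → ℂ := fun z => ellipticNum α γ s k d s₁ c₁ d₁ z / ellipticDen α γ s s₁ c₁ z with hV
  have hden : ∀ x : ℝ, ellipticDen α γ s s₁ c₁ x ≠ 0 := by
    intro x
    simp [ellipticDen, hs₁, hc₁, hα.ne']
  have hVd : ∀ x : ℝ, V x = d x := by
    intro x
    have : (α : ℂ) ≠ 0 := by exact_mod_cast hα.ne'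
    simp only [hV, ellipticNum, ellipticDen, ofReal_re, ofReal_im, hs₁, hc₁, hd₁]
    simp only [ofReal_zero, ofReal_one]
    field_simp
    ring
  have hsq : α ^ 2 = β ^ 2 + γ ^ 2 := by rw [hγ2]; ring
  have hdc : Continuous (ellipticDen α γ s s₁ c₁) := by
    have := hj.continuous_s
    have := hj₁.continuous_s
    have := hj₁.continuous_c
    unfold ellipticDen; fun_prop
  have han : ∀ x : ℝ, AnalyticAt ℂ V x := by
    intro x
    refine analyticAt_of_differentiable_on_punctured_nhds_of_continuousAt ?_
      (differentiableAt_elliptic hj hj₁ hsq (hden x)).continuousAt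
    filter_upwards [(hdc.continuousAt.eventually_ne (hden x)).filter_mono nhdsWithin_le_nhds]
      with w hw
    exact differentiableAt_elliptic hj hj₁ hsq hw
  have hode : ∀ x, deriv d x ^ 2 = (α ^ 2 - d x ^ 2) * (d x ^ 2 - β ^ 2) := by
    intro x
    rw [(hj.hasDerivAt_d x).deriv, hj.d_sq]
    have h1 : k x ^ 2 = 1 - s x ^ 2 := by linear_combination hj.sq_add_sq x
    have h2 : (-((α ^ 2 - β ^ 2) * (s x * k x))) ^ 2 =
      (α ^ 2 - β ^ 2) ^ 2 * (s x ^ 2 * k x ^ 2) := by ring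
    rw [h2, h1]; ring
  have hd0 : d 0 = 2 * ‖b‖ := by
    have h1 := hj.d_sq 0
    have h2 := hj.sq_add_sq 0
    have h3 : s 0 ^ 2 = r ^ 2 := by
      rw [hs0, hsin]; split_ifs <;> simp
    refine (sq_eq_sq₀ (hj.d_pos 0).le (by positivity)).1 ?_
    have h4 : r ^ 2 * γ ^ 2 = α ^ 2 - (2 * ‖b‖) ^ 2 := by rw [hr2]; field_simp
    rw [h1, show k 0 ^ 2 = 1 - s 0 ^ 2 by linarith, h3]
    linear_combination -h4 + r ^ 2 * hγ2
  refine ⟨d, ⟨hj.d_pos, fun x _ => ?_, fun x => ?_, hd0, fun _ => hj.exists_ne hlt2.ne,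
    fun hc => ?_⟩, V, T, T₁, meromorphicAt_elliptic hα hγ0 hj hj₁ hsq, hj.period_pos,
    hj₁.period_pos, fun z => ?_, fun z => ?_, hVd⟩
  · have h1 : AnalyticAt ℝ (fun x : ℝ => (V x).re) x :=
      (reCLM.analyticAt _).comp_of_eq (((han x).restrictScalars (𝕜 := ℝ)).comp_of_eq
        (ofRealCLM.analyticAt x) rfl) rfl
    refine h1.congr (Filter.Eventually.of_forall fun y => ?_)
    simp [hVd]
  · rw [hode, ht.quartic]
  · have h1 : deriv d 0 ^ 2 = (4 * c * ‖b‖) ^ 2 := by rw [hode, hd0, hin]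
    have h2 : deriv d 0 ≠ 0 := by
      intro h0
      rw [h0] at h1
      have : 4 * c * ‖b‖ ≠ 0 := by positivity
      exact this (by simpa using h1.symm)
    have h3 : deriv d 0 = -(γ ^ 2 * (Real.sin φ₀ * Real.cos φ₀)) := by
      rw [(hj.hasDerivAt_d 0).deriv, hγ2, hs0, hk0]
    rcases lt_or_gt_of_ne hc with hc' | hc'
    · rw [hsin, if_neg (not_le.2 hc')] at h3
      have h4 : 0 ≤ deriv d 0 := by
        rw [h3, show -(γ ^ 2 * (-r * Real.cos φ₀)) = γ ^ 2 * (r * Real.cos φ₀) by ring]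
        positivity
      rw [sign_pos (lt_of_le_of_ne h4 h2.symm), sign_pos (by linarith)]
    · rw [hsin, if_pos hc'.le] at h3
      have h4 : deriv d 0 ≤ 0 := by
        rw [h3, neg_nonpos]
        positivity
      rw [sign_neg (lt_of_le_of_ne h4 h2), sign_neg (by linarith)]
  · simp [hV, ellipticNum, ellipticDen, hj.periodic_s z.re, hj.periodic_c z.re, hj.periodic_d z.re]
  · simp [hV, ellipticNum, ellipticDen, hj₁.periodic_s z.im, hj₁.periodic_c z.im,
      hj₁.periodic_d z.im]

theorem exists_isProfile (ha : a ≠ 0) (hb : b ≠ 0) (c : ℝ) :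
    ∃ v, IsProfile a b c v ∧ IsRestrictionOfElliptic v := by
  obtain ⟨α, β, ht⟩ := exists_isTurning ha hb c
  by_cases h : IsVacuum a b c
  · exact exists_isProfile_of_isVacuum hb h
  · exact exists_isProfile_of_not_isVacuum ht hb h

/-! ### The second order equation and uniqueness of the profile. -/

theorem IsProfile.hasDerivAt (hv : IsProfile a b c v) (x : ℝ) : HasDerivAt v (deriv v x) x :=
  (hv.analytic x trivial).differentiableAt.hasDerivAt

theorem IsProfile.deriv_zero (hv : IsProfile a b c v) : deriv v 0 = -(4 * c * ‖b‖) := by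
  have h1 := hv.ode 0
  rw [hv.initial, norm_mul] at h1
  have h2 : deriv v 0 ^ 2 = (4 * c * ‖b‖) ^ 2 := by rw [h1]; ring
  by_cases hc : c = 0
  · rw [hc] at h2 ⊢; simpa using h2
  have hs := hv.sign_deriv hc
  have hb := hv.pos 0
  rw [hv.initial] at hb
  rcases sq_eq_sq_iff_eq_or_eq_neg.1 h2 with h | h
  · exfalso
    rcases lt_or_gt_of_ne hc with hc' | hc'
    · have : deriv v 0 < 0 := by rw [h]; nlinarith
      rw [sign_neg this, sign_pos (by linarith)] at hs
      exact absurd hs (by decide)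
    · have : 0 < deriv v 0 := by rw [h]; nlinarith
      rw [sign_pos this, sign_neg (by linarith)] at hs
      exact absurd hs (by decide)
  · exact h

/-- Differentiating the first order equation gives this one multiplied by `v'`. The factor cancels
near a point where `v' ≠ 0`, and the identity theorem spreads the result to the whole line. In the
vacuum case `v` is the constant `α`, an equilibrium. -/
theorem IsProfile.hasDerivAt_deriv (hv : IsProfile a b c v) (ht : IsTurning a b c α β) (x : ℝ) :
    HasDerivAt (deriv v)
      (-2 * v x ^ 3 + 4 * (‖a‖ ^ 2 + ‖b‖ ^ 2 + c ^ 2) * v x) x := by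
  set K := ‖a‖ ^ 2 + ‖b‖ ^ 2 + c ^ 2 with hK
  have hdan : AnalyticOnNhd ℝ (deriv v) Set.univ := hv.analytic.deriv
  have hdd : ∀ x, HasDerivAt (deriv v) (deriv (deriv v) x) x := fun x =>
    (hdan x trivial).differentiableAt.hasDerivAt
  suffices h : ∀ x, deriv (deriv v) x - (-2 * v x ^ 3 + 4 * K * v x) = 0 by
    have := hdd x
    rwa [sub_eq_zero.1 (h x)] at this
  have hmul : ∀ x, deriv v x * (deriv (deriv v) x - (-2 * v x ^ 3 + 4 * K * v x)) = 0 := by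
    intro x
    have h1 := (hdd x).pow 2
    have h2 := ((((hv.hasDerivAt x).pow 4).neg).add (((hv.hasDerivAt x).pow 2).const_mul
      (4 * K))).sub_const (16 * ‖a * b‖ ^ 2)
    have h3 := (h1.congr_of_eventuallyEq (Filter.Eventually.of_forall fun y =>
      (hv.ode y).symm)).unique h2
    simp only [Nat.cast_ofNat] at h3
    norm_num at h3
    linear_combination h3 / 2
  have han : AnalyticOnNhd ℝ (fun x => deriv (deriv v) x - (-2 * v x ^ 3 + 4 * K * v x))
      Set.univ := by
    intro x hx
    have h1 := hv.analytic x hx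
    have h2 := hdan.deriv x hx
    fun_prop
  by_cases hvac : IsVacuum a b c
  · have h1 : ∀ x, v x = α := by
      intro x
      have := hv.sq_mem_Icc ht x
      rw [ht.isVacuum_iff.1 hvac] at this
      exact (sq_eq_sq₀ (hv.pos x).le (ht.pos.trans_le ht.le).le).1 (le_antisymm this.2 this.1)
    have h2 : v = fun _ => α := funext h1
    have h3 := ht.sq_add_sq
    rw [ht.isVacuum_iff.1 hvac] at h3
    intro x
    simp only [h2, deriv_const', deriv_const]
    linear_combination α * h3
  · obtain ⟨y, hy⟩ : ∃ y, deriv v y ≠ 0 := by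
      by_contra! h
      obtain ⟨z, hz⟩ := hv.nonconstant hvac
      exact hz (is_const_of_deriv_eq_zero (fun x => (hv.hasDerivAt x).differentiableAt) h z 0)
    have hev : ∀ᶠ z in nhds y, deriv (deriv v) z - (-2 * v z ^ 3 + 4 * K * v z) = 0 := by
      filter_upwards [(hdan y trivial).continuousAt.eventually_ne hy] with z hz
      exact (mul_eq_zero.1 (hmul z)).resolve_left hz
    exact fun x => han.eqOn_zero_of_preconnected_of_eventuallyEq_zero isPreconnected_univ
      (Set.mem_univ y) hev (Set.mem_univ x)

/-- Uniqueness for a second order linear scalar equation with a bounded coefficient. -/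
theorem eq_zero_of_hasDerivAt_deriv {u u' q : ℝ → ℝ} {M : ℝ} (hu : ∀ x, HasDerivAt u (u' x) x)
    (hu' : ∀ x, HasDerivAt u' (q x * u x) x) (hq : ∀ x, |q x| ≤ M) (h0 : u 0 = 0)
    (h0' : u' 0 = 0) : u = 0 := by
  have hM : 0 ≤ M := (abs_nonneg _).trans (hq 0)
  have hlip : ∀ t, LipschitzOnWith (max 1 M).toNNReal
      (fun p : ℝ × ℝ => (p.2, q t * p.1)) Set.univ := by
    intro t
    refine LipschitzOnWith.of_dist_le_mul fun p _ r _ => ?_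
    rw [Real.coe_toNNReal _ (le_max_of_le_left zero_le_one), Prod.dist_eq, Prod.dist_eq]
    simp only [Real.dist_eq]
    rw [← mul_sub, abs_mul]
    have h1 := le_max_left (1 : ℝ) M
    have h2 := le_max_right (1 : ℝ) M
    refine max_le ?_ ?_
    · calc |p.2 - r.2| ≤ 1 * max |p.1 - r.1| |p.2 - r.2| := by rw [one_mul]; exact le_max_right _ _
        _ ≤ _ := by gcongr
    · exact mul_le_mul ((hq t).trans h2) (le_max_left _ _) (abs_nonneg _) (by positivity)
  have h := ODE_solution_unique_univ (f := fun t => (u t, u' t)) (g := fun _ => (0, 0)) (t₀ := 0)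
    (v := fun t (p : ℝ × ℝ) => (p.2, q t * p.1)) hlip
    (fun t => ⟨(hu t).prodMk (hu' t), trivial⟩)
    (fun t => ⟨(hasDerivAt_const t ((0 : ℝ), (0 : ℝ))).congr_deriv (by simp [Prod.zero_eq_mk]), trivial⟩) (by simp [h0, h0'])
  funext t
  exact congrArg Prod.fst (congrFun h t)

theorem IsProfile.eq (ha : a ≠ 0) (hb : b ≠ 0) (hv : IsProfile a b c v) (hw : IsProfile a b c w) :
    v = w := by
  obtain ⟨α, β, ht⟩ := exists_isTurning ha hb c
  set K := ‖a‖ ^ 2 + ‖b‖ ^ 2 + c ^ 2 with hK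
  have h := eq_zero_of_hasDerivAt_deriv (u := fun x => v x - w x)
    (u' := fun x => deriv v x - deriv w x)
    -- The difference `v - w` solves a linear equation because `v³ - w³` has the factor `v - w`; the
    -- bound comes from `v², w² ≤ α²`.
    (q := fun x => -2 * (v x ^ 2 + v x * w x + w x ^ 2) + 4 * K) (M := 6 * α ^ 2 + 4 * K)
    (fun x => (hv.hasDerivAt x).sub (hw.hasDerivAt x))
    (fun x => ((hv.hasDerivAt_deriv ht x).sub (hw.hasDerivAt_deriv ht x)).congr_deriv (by ring))
    (fun x => ?_) (by simp [hv.initial, hw.initial]) (by simp [hv.deriv_zero, hw.deriv_zero])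
  · funext x
    have := congrFun h x
    simpa [sub_eq_zero] using this
  · have h1 := (hv.sq_mem_Icc ht x).2
    have h2 := (hw.sq_mem_Icc ht x).2
    have h3 : 0 < v x * w x := mul_pos (hv.pos x) (hw.pos x)
    have h4 : 0 ≤ K := by positivity
    rw [abs_le]
    constructor <;> nlinarith [sq_nonneg (v x - w x)]

end

section

/-! ### Linear differential equations with a spectral parameter -/

section LinearODE

variable {𝔸 : Type*} [NormedRing 𝔸] [NormedAlgebra ℂ 𝔸]

/-- The iterated integrals `∫ N(t₁) N(t₂) ⋯ N(tₙ)` over `x ≥ t₁ ≥ ⋯ ≥ tₙ ≥ 0`. -/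
noncomputable def iteratedIntegral (N : ℝ → 𝔸) : ℕ → ℝ → 𝔸
  | 0, _ => 1
  | n + 1, x => ∫ t in (0 : ℝ)..x, N t * iteratedIntegral N n t

variable {N : ℝ → 𝔸}

theorem continuous_iteratedIntegral (hN : Continuous N) (n : ℕ) :
    Continuous (iteratedIntegral N n) := by
  induction n with
  | zero => exact continuous_const
  | succ n ih =>
    exact intervalIntegral.continuous_primitive (μ := MeasureTheory.volume)
      (fun _ _ => (hN.mul ih).intervalIntegrable _ _) 0

theorem hasDerivAt_iteratedIntegral [CompleteSpace 𝔸] (hN : Continuous N) (n : ℕ) (x : ℝ) :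
    HasDerivAt (iteratedIntegral N (n + 1)) (N x * iteratedIntegral N n x) x := by
  have h := hN.mul (continuous_iteratedIntegral hN n)
  exact intervalIntegral.integral_hasDerivAt_right (h.intervalIntegrable _ _)
    (h.stronglyMeasurableAtFilter _ _) h.continuousAt

/-- The factorial, the inverse volume factor of the simplex, makes the series in `l` converge
everywhere. -/
theorem norm_iteratedIntegral_le {L r : ℝ} (hL : ∀ t, |t| ≤ r → ‖N t‖ ≤ L) (n : ℕ) {x : ℝ}
    (hx : |x| ≤ r) :
    ‖iteratedIntegral N n x‖ ≤ ‖(1 : 𝔸)‖ * ((L * |x|) ^ n / n.factorial) := by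
  induction n generalizing x with
  | zero => simp [iteratedIntegral]
  | succ n ih =>
    have hL0 : 0 ≤ L := (norm_nonneg _).trans (hL 0 (by simpa using (abs_nonneg x).trans hx))
    rw [iteratedIntegral]
    -- Rescaling to `[0, 1]` treats both signs of `x` at once.
    have h1 : ∫ t in (0 : ℝ)..x, N t * iteratedIntegral N n t =
        x • ∫ s in (0 : ℝ)..1, N (x * s) * iteratedIntegral N n (x * s) := by
      rw [intervalIntegral.smul_integral_comp_mul_left
        (fun t => N t * iteratedIntegral N n t)]
      simp
    have h2 : ‖∫ s in (0 : ℝ)..1, N (x * s) * iteratedIntegral N n (x * s)‖ ≤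
        ∫ s in (0 : ℝ)..1, L * (‖(1 : 𝔸)‖ * ((L * |x|) ^ n / n.factorial)) * s ^ n := by
      refine intervalIntegral.norm_integral_le_of_norm_le zero_le_one
        (Filter.Eventually.of_forall fun s hs => ?_)
        (Continuous.intervalIntegrable (by fun_prop) _ _)
      have hs' : |x * s| ≤ r := by
        rw [abs_mul, abs_of_pos hs.1]
        exact (mul_le_of_le_one_right (abs_nonneg x) hs.2).trans hx
      calc ‖N (x * s) * iteratedIntegral N n (x * s)‖
          ≤ ‖N (x * s)‖ * ‖iteratedIntegral N n (x * s)‖ := norm_mul_le _ _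
        _ ≤ L * (‖(1 : 𝔸)‖ * ((L * |x * s|) ^ n / n.factorial)) :=
          mul_le_mul (hL _ hs') (ih hs') (norm_nonneg _) hL0
        _ = _ := by rw [abs_mul, abs_of_pos hs.1]; ring
    rw [intervalIntegral.integral_const_mul, integral_pow] at h2
    rw [h1, norm_smul, Real.norm_eq_abs]
    refine (mul_le_mul_of_nonneg_left h2 (abs_nonneg x)).trans (le_of_eq ?_)
    rw [Nat.factorial_succ]
    push_cast
    have : ((n : ℝ) + 1) ≠ 0 := by positivity
    field_simp
    simp only [one_pow, ne_eq, Nat.succ_ne_zero, not_false_eq_true, zero_pow, sub_zero]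
    ring

theorem exists_norm_le_of_continuous {E : Type*} [NormedAddCommGroup E] {N : ℝ → E}
    (hN : Continuous N) (r : ℝ) :
    ∃ L : ℝ, 0 ≤ L ∧ ∀ t, |t| ≤ r → ‖N t‖ ≤ L := by
  obtain ⟨L, hL⟩ := (isCompact_Icc (a := -r) (b := r)).exists_bound_of_continuousOn hN.continuousOn
  exact ⟨max L 0, le_max_right _ _, fun t ht => (hL t (abs_le.1 ht)).trans (le_max_left _ _)⟩

/-- The fundamental solution of `C' = l N C`, as a power series in the parameter `l`. -/
noncomputable def fundamentalSolution (N : ℝ → 𝔸) (x : ℝ) (l : ℂ) : 𝔸 :=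
  ∑' n : ℕ, l ^ n • iteratedIntegral N n x

theorem summable_bound (A B C : ℝ) : Summable fun n : ℕ => A ^ n * (B * (C ^ n / n.factorial)) := by
  refine ((Real.summable_pow_div_factorial (A * C)).mul_left B).congr fun n => ?_
  rw [mul_pow]; ring

theorem norm_fundamentalSolution_term_le {L r : ℝ} (hL0 : 0 ≤ L) (hL : ∀ t, |t| ≤ r → ‖N t‖ ≤ L)
    (n : ℕ) {x : ℝ} (hx : |x| ≤ r) {l : ℂ} {q : ℝ} (hq : ‖l‖ ≤ q) :
    ‖l ^ n • iteratedIntegral N n x‖ ≤ q ^ n * (‖(1 : 𝔸)‖ * ((L * r) ^ n / n.factorial)) := by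
  rw [norm_smul, norm_pow]
  have hq0 : 0 ≤ q := (norm_nonneg l).trans hq
  have := norm_iteratedIntegral_le hL n hx
  refine mul_le_mul (by gcongr) (this.trans (by gcongr)) (norm_nonneg _) (by positivity)

variable [CompleteSpace 𝔸]

theorem summable_fundamentalSolution (hN : Continuous N) (x : ℝ) (l : ℂ) :
    Summable fun n : ℕ => l ^ n • iteratedIntegral N n x := by
  obtain ⟨L, hL0, hL⟩ := exists_norm_le_of_continuous hN |x|
  exact Summable.of_norm_bounded (summable_bound ‖l‖ ‖(1 : 𝔸)‖ (L * |x|))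
    fun n => norm_fundamentalSolution_term_le hL0 hL n le_rfl le_rfl

theorem differentiable_fundamentalSolution (hN : Continuous N) (x : ℝ) :
    Differentiable ℂ (fundamentalSolution N x) := by
  obtain ⟨L, hL0, hL⟩ := exists_norm_le_of_continuous hN |x|
  intro l
  have h : DifferentiableOn ℂ (fundamentalSolution N x) (Metric.ball 0 (‖l‖ + 1)) :=
    differentiableOn_tsum_of_summable_norm (summable_bound (‖l‖ + 1) ‖(1 : 𝔸)‖ (L * |x|))
      (fun n => (Differentiable.smul_const (by fun_prop) _).differentiableOn) Metric.isOpen_ball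
      fun n w hw => norm_fundamentalSolution_term_le hL0 hL n le_rfl
        (mem_ball_zero_iff.1 hw).le
  exact h.differentiableAt (Metric.isOpen_ball.mem_nhds (by simp))

theorem fundamentalSolution_eq (hN : Continuous N) (x : ℝ) (l : ℂ) :
    fundamentalSolution N x l = 1 + ∑' n : ℕ, l ^ (n + 1) • iteratedIntegral N (n + 1) x := by
  rw [fundamentalSolution, (summable_fundamentalSolution hN x l).tsum_eq_zero_add]
  simp [iteratedIntegral]

theorem fundamentalSolution_zero_left (hN : Continuous N) (l : ℂ) :
    fundamentalSolution N 0 l = 1 := by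
  simp [fundamentalSolution_eq hN, iteratedIntegral]

theorem fundamentalSolution_zero_right (hN : Continuous N) (x : ℝ) :
    fundamentalSolution N x 0 = 1 := by
  simp [fundamentalSolution_eq hN]

theorem hasDerivAt_fundamentalSolution (hN : Continuous N) (x : ℝ) (l : ℂ) :
    HasDerivAt (fun x => fundamentalSolution N x l) (l • (N x * fundamentalSolution N x l)) x := by
  obtain ⟨L, hL0, hL⟩ := exists_norm_le_of_continuous hN (|x| + 1)
  -- Termwise differentiation needs bounds on an open ball containing `x`.
  set r := |x| + 1 with hr
  have hmem : ∀ y ∈ Metric.ball (0 : ℝ) r, |y| ≤ r := fun y hy => by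
    have := mem_ball_zero_iff.1 hy
    rw [Real.norm_eq_abs] at this
    exact this.le
  have hbd : ∀ (n : ℕ) (y : ℝ), y ∈ Metric.ball (0 : ℝ) r →
      ‖l ^ (n + 1) • (N y * iteratedIntegral N n y)‖ ≤
        ‖l‖ * (L * (‖l‖ ^ n * (‖(1 : 𝔸)‖ * ((L * r) ^ n / n.factorial)))) := by
    intro n y hy
    have h1 := norm_fundamentalSolution_term_le hL0 hL n (hmem y hy) (le_refl ‖l‖)
    rw [pow_succ', mul_smul, norm_smul, ← mul_smul_comm]
    exact mul_le_mul_of_nonneg_left ((norm_mul_le _ _).trans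
      (mul_le_mul (hL y (hmem y hy)) h1 (norm_nonneg _) hL0)) (norm_nonneg l)
  have hd : ∀ (n : ℕ) (y : ℝ), y ∈ Metric.ball (0 : ℝ) r →
      HasDerivAt (fun y => l ^ (n + 1) • iteratedIntegral N (n + 1) y)
        (l ^ (n + 1) • (N y * iteratedIntegral N n y)) y := fun n y _ =>
    (hasDerivAt_iteratedIntegral hN n y).fun_const_smul (l ^ (n + 1))
  have h0 : Summable fun n : ℕ => l ^ (n + 1) • iteratedIntegral N (n + 1) 0 := by
    simp [iteratedIntegral]
  have h := hasDerivAt_tsum_of_isPreconnected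
    (((summable_bound ‖l‖ ‖(1 : 𝔸)‖ (L * r)).mul_left L).mul_left ‖l‖)
    Metric.isOpen_ball (convex_ball 0 r).isPreconnected hd hbd
    (Metric.mem_ball_self (by positivity)) h0 (y := x) (by simp [hr])
  have h2 := (h.const_add (1 : 𝔸)).congr_of_eventuallyEq
    (Filter.Eventually.of_forall fun y => fundamentalSolution_eq hN y l)
  refine h2.congr_deriv ?_
  rw [fundamentalSolution, ← (summable_fundamentalSolution hN x l).tsum_mul_left,
    ← ((summable_fundamentalSolution hN x l).mul_left _).tsum_const_smul]
  congr 1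
  funext n
  rw [mul_smul_comm, smul_smul, pow_succ']

end LinearODE

end

section

/-! ### Entrywise calculus for matrix-valued functions -/

/-- The entries of `M` are differentiable at `x` and their derivatives are the entries of `M'`. -/
def HasEntryDerivAt (M : ℝ → Mat2) (M' : Mat2) (x : ℝ) : Prop :=
  ∀ i j, HasDerivAt (fun t => M t i j) (M' i j) x

variable {M N : ℝ → Mat2} {M' N' : Mat2} {x : ℝ}

theorem HasEntryDerivAt.congr_deriv (hM : HasEntryDerivAt M M' x) (h : M' = N') :
    HasEntryDerivAt M N' x := h ▸ hM

theorem HasEntryDerivAt.mul (hM : HasEntryDerivAt M M' x) (hN : HasEntryDerivAt N N' x) :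
    HasEntryDerivAt (fun t => M t * N t) (M' * N x + M x * N') x := by
  intro i j
  simp only [Matrix.mul_apply, Fin.sum_univ_two, Matrix.add_apply]
  exact ((((hM i 0).mul (hN 0 j)).add ((hM i 1).mul (hN 1 j))).congr_deriv (by ring))

theorem HasEntryDerivAt.conjTranspose (hM : HasEntryDerivAt M M' x) :
    HasEntryDerivAt (fun t => (M t)ᴴ) M'ᴴ x := by
  intro i j
  simp only [Matrix.conjTranspose_apply]
  exact (hM j i).star

theorem HasEntryDerivAt.adjugate (hM : HasEntryDerivAt M M' x) :
    HasEntryDerivAt (fun t => (M t).adjugate) M'.adjugate x := by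
  intro i j
  fin_cases i <;> fin_cases j <;> simp only [Matrix.adjugate_fin_two] <;> simp
  · exact hM 1 1
  · exact (hM 0 1).neg
  · exact (hM 1 0).neg
  · exact hM 0 0

theorem HasEntryDerivAt.det (hM : HasEntryDerivAt M M' x) :
    HasDerivAt (fun t => (M t).det)
      (M' 0 0 * M x 1 1 + M x 0 0 * M' 1 1 - (M' 0 1 * M x 1 0 + M x 0 1 * M' 1 0)) x := by
  simp only [Matrix.det_fin_two]
  exact ((hM 0 0).mul (hM 1 1)).sub ((hM 0 1).mul (hM 1 0))

theorem eq_of_hasEntryDerivAt_zero (h : ∀ x, HasEntryDerivAt M 0 x) (x y : ℝ) : M x = M y := by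
  ext i j
  exact is_const_of_deriv_eq_zero (fun t => (h t i j).differentiableAt)
    (fun t => (h t i j).deriv) x y

/-- Liouville's formula: `(det M)' = tr Y · det M`. -/
theorem det_eq_of_hasEntryDerivAt {Y : ℝ → Mat2} (h : ∀ x, HasEntryDerivAt M (Y x * M x) x)
    (hY : ∀ x, (Y x).trace = 0) (x y : ℝ) : (M x).det = (M y).det := by
  have hd : ∀ t, HasDerivAt (fun t => (M t).det) 0 t := by
    intro t
    refine (h t).det.congr_deriv ?_
    have h1 : Y t 1 1 = -Y t 0 0 := by
      have := hY t
      rw [Matrix.trace_fin_two] at this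
      linear_combination this
    simp only [Matrix.mul_apply, Fin.sum_univ_two, h1]
    ring
  exact is_const_of_deriv_eq_zero (fun t => (hd t).differentiableAt) (fun t => (hd t).deriv) x y

theorem adjugate_eq_neg_of_trace_eq_zero {A : Mat2} (h : A.trace = 0) : A.adjugate = -A := by
  rw [Matrix.trace_fin_two] at h
  rw [Matrix.adjugate_fin_two]
  ext i j
  fin_cases i <;> fin_cases j <;> simp
  · linear_combination h
  · linear_combination h

theorem adjugate_mul_self {A : Mat2} (h : A.det = 1) : A.adjugate * A = 1 := by
  rw [Matrix.adjugate_mul, h, one_smul]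

theorem mul_adjugate_self {A : Mat2} (h : A.det = 1) : A * A.adjugate = 1 := by
  rw [Matrix.mul_adjugate, h, one_smul]

/-! ### Entire solutions and matrix exponentials, stated by entries so that the norm stays local. -/

section Norm

attribute [local instance] Matrix.linftyOpNormedRing Matrix.linftyOpNormedAlgebra

/-- Evaluation at an entry, as a continuous linear map. -/
noncomputable def entryCLM (i j : Fin 2) : Mat2 →L[ℂ] ℂ :=
  LinearMap.toContinuousLinearMap (Matrix.entryLinearMap ℂ ℂ i j)

theorem exists_entire_solution {N : ℝ → Mat2} (hN : ∀ i j, Continuous fun x => N x i j) :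
    ∃ C : ℝ → ℂ → Mat2, (∀ l, C 0 l = 1) ∧ (∀ x, C x 0 = 1) ∧
      (∀ x l, HasEntryDerivAt (fun t => C t l) (l • (N x * C x l)) x) ∧
      ∀ x i j, Differentiable ℂ fun l => C x l i j := by
  have hN' : Continuous N := continuous_pi fun i => continuous_pi fun j => hN i j
  refine ⟨fundamentalSolution N, fundamentalSolution_zero_left hN',
    fundamentalSolution_zero_right hN', fun x l i j => ?_, fun x i j => ?_⟩
  · exact ((entryCLM i j).restrictScalars ℝ).hasFDerivAt.comp_hasDerivAt x
      (hasDerivAt_fundamentalSolution hN' x l)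
  · exact (entryCLM i j).differentiable.comp (differentiable_fundamentalSolution hN' x)

theorem hasEntryDerivAt_exp_smul (A : Mat2) {f : ℝ → ℂ} {f' : ℂ} {x : ℝ}
    (hf : HasDerivAt f f' x) :
    HasEntryDerivAt (fun t => NormedSpace.exp (f t • A))
      (f' • (A * NormedSpace.exp (f x • A))) x := by
  intro i j
  have h1 : HasDerivAt (fun u : ℂ => (NormedSpace.exp (u • A)) i j)
      ((A * NormedSpace.exp (f x • A)) i j) (f x) :=
    (entryCLM i j).hasFDerivAt.comp_hasDerivAt (f x) (hasDerivAt_exp_smul_const' A (f x))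
  exact h1.scomp x hf

theorem analyticAt_exp_entry {𝕜 E : Type*} [RCLike 𝕜] [NormedAlgebra 𝕜 ℂ]
    [NormedAddCommGroup E] [NormedSpace 𝕜 E] {f : E → Mat2} {q : E}
    (hf : ∀ i j, AnalyticAt 𝕜 (fun p => f p i j) q) (i j : Fin 2) :
    AnalyticAt 𝕜 (fun p => (NormedSpace.exp (f p)) i j) q := by
  have h1 : AnalyticAt 𝕜 f q := by
    have h2 : f = fun p => ∑ i, ∑ j, f p i j • Matrix.single i j (1 : ℂ) := by
      funext p
      conv_lhs => rw [Matrix.matrix_eq_sum_single (f p)]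
      simp
    rw [h2]
    exact Finset.analyticAt_fun_sum _ fun i _ => Finset.analyticAt_fun_sum _ fun j _ =>
      (hf i j).smul analyticAt_const
  exact ((entryCLM i j).restrictScalars 𝕜).analyticAt _ |>.comp
    ((NormedSpace.exp_analytic (𝕂 := 𝕜) (f q)).comp h1)

end Norm

theorem exp_smul_add (A : Mat2) (s t : ℂ) :
    NormedSpace.exp ((s + t) • A) = NormedSpace.exp (s • A) * NormedSpace.exp (t • A) := by
  rw [add_smul]
  exact Matrix.exp_add_of_commute _ _ (((Commute.refl A).smul_left s).smul_right t)

theorem exp_smul_mul_comm (A : Mat2) (s : ℂ) :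
    A * NormedSpace.exp (s • A) = NormedSpace.exp (s • A) * A :=
  (((Commute.refl A).smul_right s).exp_right).eq

theorem det_exp_smul {A : Mat2} (h : A.trace = 0) (s : ℂ) : (NormedSpace.exp (s • A)).det = 1 := by
  have h1 : ∀ x : ℝ, HasEntryDerivAt (fun t : ℝ => NormedSpace.exp ((t * s : ℂ) • A))
      ((s • A) * NormedSpace.exp ((x * s : ℂ) • A)) x := by
    intro x
    refine (hasEntryDerivAt_exp_smul A (((hasDerivAt_id x).ofReal_comp).mul_const s)).congr_deriv ?_
    simp
  have h2 := det_eq_of_hasEntryDerivAt h1 (fun _ => by simp [h]) 1 0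
  simpa using h2

end

section

/-! ### The Lax equation and the positive factor -/

/-- The evolution of the coefficients `a / m`, `b * m`, `k` of a Delaunay residue under the
Lax equation. -/
structure IsLaxFlow (a b : ℂ) (c : ℝ) (m k : ℝ → ℝ) : Prop where
  pos : ∀ x, 0 < m x
  m_zero : m 0 = 1
  k_zero : k 0 = c
  hasDerivAt_m : ∀ x, HasDerivAt m (-(2 * k x * m x)) x
  hasDerivAt_k : ∀ x, HasDerivAt k (2 * (‖b‖ ^ 2 * m x ^ 2 - ‖a‖ ^ 2 * (m x)⁻¹ ^ 2)) x
  energy : ∀ x, k x ^ 2 + ‖a‖ ^ 2 * (m x)⁻¹ ^ 2 + ‖b‖ ^ 2 * m x ^ 2 = ‖a‖ ^ 2 + ‖b‖ ^ 2 + c ^ 2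

variable {a b : ℂ} {c α β : ℝ} {v m k : ℝ → ℝ}

/-- The energy identity is the equation of the profile divided by `4v²`. The equation for `k` also
needs the second order equation. -/
theorem IsProfile.isLaxFlow (hb : b ≠ 0) (hv : IsProfile a b c v) (ht : IsTurning a b c α β) :
    IsLaxFlow a b c (fun x => v x / (2 * ‖b‖)) (fun x => -deriv v x / (2 * v x)) := by
  have hb' : ‖b‖ ≠ 0 := norm_ne_zero_iff.2 hb
  have hv0 : ∀ x, v x ≠ 0 := fun x => (hv.pos x).ne'
  refine ⟨fun x => by have := hv.pos x; positivity, ?_, ?_, fun x => ?_, fun x => ?_, fun x => ?_⟩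
  · simp only [hv.initial]; field_simp
  · simp only [hv.initial, hv.deriv_zero]; field_simp; ring
  · refine ((hv.hasDerivAt x).div_const (2 * ‖b‖)).congr_deriv ?_
    have := hv0 x
    field_simp
  · have := hv0 x
    refine ((hv.hasDerivAt_deriv ht x).neg.div ((hv.hasDerivAt x).const_mul 2)
      (by simpa using hv0 x)).congr_deriv ?_
    have h := hv.ode x
    rw [norm_mul] at h
    simp only [Pi.neg_apply]
    field_simp
    linear_combination h
  · have := hv0 x
    have h := hv.ode x
    rw [norm_mul] at h
    field_simp
    linear_combination h

/-- The positive part of the Lax matrix. -/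
noncomputable def posPart (a b : ℂ) (m k : ℝ) (l : ℂ) : Mat2 :=
  !![(k : ℂ), 2 * conj b * m; 2 * conj a * (m : ℂ)⁻¹ * l, -(k : ℂ)]

/-- The Lax matrix. -/
noncomputable def laxMatrix (a b : ℂ) (m k : ℝ) (l : ℂ) : Mat2 :=
  residue (a * (m : ℂ)⁻¹) (b * m) k l

theorem trace_posPart (m k : ℝ) (l : ℂ) : (posPart a b m k l).trace = 0 := by
  simp [posPart, Matrix.trace_fin_two]

theorem trace_residue (l : ℂ) : (residue a b c l).trace = 0 := by
  simp [residue, Matrix.trace_fin_two]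

theorem norm_sq_eq (z : ℂ) : ((‖z‖ : ℝ) : ℂ) ^ 2 = conj z * z := (conj_mul' z).symm

theorem IsLaxFlow.hasDerivAt_m' (h : IsLaxFlow a b c m k) (x : ℝ) :
    HasDerivAt (fun t => (m t : ℂ)) (-(2 * k x * m x)) x :=
  (h.hasDerivAt_m x).ofReal_comp.congr_deriv (by push_cast; ring)

theorem IsLaxFlow.ne_zero (h : IsLaxFlow a b c m k) (x : ℝ) : (m x : ℂ) ≠ 0 := by
  exact_mod_cast (h.pos x).ne'

theorem IsLaxFlow.hasDerivAt_m_inv (h : IsLaxFlow a b c m k) (x : ℝ) :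
    HasDerivAt (fun t => (m t : ℂ)⁻¹) (2 * k x * (m x : ℂ)⁻¹) x := by
  refine ((h.hasDerivAt_m' x).inv (h.ne_zero x)).congr_deriv ?_
  have := h.ne_zero x
  field_simp

theorem IsLaxFlow.hasDerivAt_k' (h : IsLaxFlow a b c m k) (x : ℝ) :
    HasDerivAt (fun t => (k t : ℂ))
      (2 * (conj b * b * m x ^ 2 - conj a * a * (m x : ℂ)⁻¹ ^ 2)) x := by
  refine (h.hasDerivAt_k x).ofReal_comp.congr_deriv ?_
  push_cast
  rw [norm_sq_eq, norm_sq_eq]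

theorem IsLaxFlow.energy' (h : IsLaxFlow a b c m k) (x : ℝ) :
    (k x : ℂ) ^ 2 + conj a * a * (m x : ℂ)⁻¹ ^ 2 + conj b * b * m x ^ 2 =
      conj a * a + conj b * b + c ^ 2 := by
  have := congrArg (fun t : ℝ => (t : ℂ)) (h.energy x)
  push_cast at this
  rwa [norm_sq_eq, norm_sq_eq] at this

/-- The Lax equation. -/
theorem IsLaxFlow.hasEntryDerivAt_laxMatrix (h : IsLaxFlow a b c m k) {l : ℂ} (hl : l ≠ 0)
    (x : ℝ) :
    HasEntryDerivAt (fun t => laxMatrix a b (m t) (k t) l)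
      (posPart a b (m x) (k x) l * laxMatrix a b (m x) (k x) l -
        laxMatrix a b (m x) (k x) l * posPart a b (m x) (k x) l) x := by
  have h1 := h.hasDerivAt_m' x
  have h2 := h.hasDerivAt_m_inv x
  have h3 := h.hasDerivAt_k' x
  have h0 := h.ne_zero x
  have e : ∀ t, laxMatrix a b (m t) (k t) l =
      !![(k t : ℂ), a * l⁻¹ * (m t : ℂ)⁻¹ + conj b * m t;
        b * m t + conj a * l * (m t : ℂ)⁻¹, -(k t : ℂ)] := by
    intro t
    simp only [laxMatrix, residue, map_mul, map_inv₀, conj_ofReal]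
    congr 1
    ext i j
    fin_cases i <;> fin_cases j <;> simp <;> ring
  simp only [e]
  intro i j
  fin_cases i <;> fin_cases j <;>
    simp [posPart]
  · refine h3.congr_deriv ?_
    field_simp; ring
  · refine ((h2.const_mul _).add (h1.const_mul _)).congr_deriv ?_
    field_simp; ring
  · refine ((h1.const_mul _).add (h2.const_mul _)).congr_deriv ?_
    field_simp; ring
  · refine h3.neg.congr_deriv ?_
    field_simp; ring

/-! ### The positive factor and unitarity of the other one. -/

/-- The solution of `B' = posPart * B`, `B(0) = 1`. -/
structure IsPosSolution (a b : ℂ) (m k : ℝ → ℝ) (B : ℝ → ℂ → Mat2) : Prop where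
  zero_left : ∀ l, B 0 l = 1
  hasEntryDerivAt : ∀ x l,
    HasEntryDerivAt (fun t => B t l) (posPart a b (m x) (k x) l * B x l) x
  differentiable : ∀ x i j, Differentiable ℂ fun l => B x l i j
  zero_right : ∀ x, IsPosUpperTriangular (B x 0)

theorem IsPosSolution.det_eq_one {B : ℝ → ℂ → Mat2} (hB : IsPosSolution a b m k B) (x : ℝ)
    (l : ℂ) : (B x l).det = 1 := by
  rw [det_eq_of_hasEntryDerivAt (fun x => hB.hasEntryDerivAt x l)
    (fun x => trace_posPart (m x) (k x) l) x 0, hB.zero_left, Matrix.det_one]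

/-- Write `posPart` at `l` as its value at `0` plus `l • N`. The value at `0` is upper triangular
and is integrated explicitly by `P`. Then `B = P C` reduces the equation to `C' = l (P⁻¹ N P) C`,
whose solution is entire in `l` and equals `1` at `l = 0`, so that `B x 0 = P x`. -/
theorem IsLaxFlow.exists_isPosSolution (h : IsLaxFlow a b c m k) :
    ∃ B, IsPosSolution a b m k B := by
  have hmc : Continuous m := continuous_iff_continuousAt.2 fun x => (h.hasDerivAt_m x).continuousAt
  -- As `m' = -2km`, the function `m^(-1/2)` solves `δ' = kδ`, the diagonal part of the equation at
  -- `l = 0`.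
  set δ : ℝ → ℝ := fun x => (√(m x))⁻¹ with hδ
  have hsq : ∀ x, 0 < √(m x) := fun x => Real.sqrt_pos.2 (h.pos x)
  have hδ0 : ∀ x, 0 < δ x := fun x => inv_pos.2 (hsq x)
  have hδ2 : ∀ x, δ x ^ 2 * m x = 1 := fun x => by
    simp only [hδ]
    rw [inv_pow, Real.sq_sqrt (h.pos x).le, inv_mul_cancel₀ (h.pos x).ne']
  have hδc : Continuous δ := hmc.sqrt.inv₀ fun x => (hsq x).ne'
  have hδd : ∀ x, HasDerivAt δ (k x * δ x) x := by
    intro x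
    refine (((h.hasDerivAt_m x).sqrt (h.pos x).ne').inv (hsq x).ne').congr_deriv ?_
    simp only [hδ]
    have h1 := Real.sq_sqrt (h.pos x).le
    have h2 := (hsq x).ne'
    field_simp
    linear_combination (-k x) * h1
  have hδd' : ∀ x, HasDerivAt (fun t => (δ t : ℂ)) (k x * δ x) x := fun x =>
    (hδd x).ofReal_comp.congr_deriv (by push_cast; ring)
  have hδ0' : ∀ x, (δ x : ℂ) ≠ 0 := fun x => by exact_mod_cast (hδ0 x).ne'
  have hδ2' : ∀ x, (δ x : ℂ) ^ 2 * m x = 1 := fun x => by exact_mod_cast hδ2 x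
  set ε : ℝ → ℂ := fun x => ∫ t in (0 : ℝ)..x, 2 * conj b * (m t : ℂ) ^ 2 with hε
  have hcont : Continuous fun t => 2 * conj b * (m t : ℂ) ^ 2 := by fun_prop
  have hεd : ∀ x, HasDerivAt ε (2 * conj b * (m x : ℂ) ^ 2) x := fun x =>
    intervalIntegral.integral_hasDerivAt_right (hcont.intervalIntegrable _ _)
      (hcont.stronglyMeasurableAtFilter _ _) hcont.continuousAt
  have hεc : Continuous ε := continuous_iff_continuousAt.2 fun x => (hεd x).continuousAt
  set P : ℝ → Mat2 := fun x => !![(δ x : ℂ), δ x * ε x; 0, (δ x : ℂ)⁻¹] with hP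
  set Q : ℝ → Mat2 := fun x => !![(δ x : ℂ)⁻¹, -(δ x * ε x); 0, (δ x : ℂ)] with hQ
  set N : ℝ → Mat2 := fun x => !![0, 0; 2 * conj a * (m x : ℂ)⁻¹, 0] with hN
  have hPQ : ∀ x, P x * Q x = 1 := by
    intro x
    have := hδ0' x
    ext i j
    fin_cases i <;> fin_cases j <;> simp [hP, hQ, Matrix.mul_apply, Fin.sum_univ_two, this]
    ring
  have hPd : ∀ x, HasEntryDerivAt P (posPart a b (m x) (k x) 0 * P x) x := by
    intro x i j
    have h0 := hδ0' x
    have h2 := hδ2' x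
    fin_cases i <;> fin_cases j <;>
      simp [hP, posPart, Matrix.mul_apply, Fin.sum_univ_two]
    · exact hδd' x
    · refine ((hδd' x).mul (hεd x)).congr_deriv ?_
      field_simp
      linear_combination (2 * conj b * m x) * h2
    · exact hasDerivAt_const _ _
    · refine ((hδd' x).inv h0).congr_deriv ?_
      field_simp
  have hNc : ∀ i j, Continuous fun x => (Q x * N x * P x) i j := by
    have hδc' : Continuous fun x => (δ x : ℂ) := by fun_prop
    have hδi : Continuous fun x => (δ x : ℂ)⁻¹ := hδc'.inv₀ hδ0'
    have hmi : Continuous fun x => (m x : ℂ)⁻¹ :=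
      (continuous_ofReal.comp hmc).inv₀ fun x => h.ne_zero x
    intro i j
    simp only [Matrix.mul_apply, Fin.sum_univ_two]
    fin_cases i <;> fin_cases j <;> simp [hP, hQ, hN] <;> fun_prop
  obtain ⟨C, hC0, hC1, hCd, hCl⟩ := exists_entire_solution hNc
  have hm1 : δ 0 = 1 := by simp [hδ, h.m_zero]
  refine ⟨fun x l => P x * C x l, fun l => ?_, fun x l => ?_, fun x i j => ?_, fun x => ?_⟩
  · rw [hC0, mul_one]
    ext i j
    fin_cases i <;> fin_cases j <;> simp [hP, hm1, hε]
  · refine ((hPd x).mul (hCd x l)).congr_deriv ?_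
    have e : posPart a b (m x) (k x) l = posPart a b (m x) (k x) 0 + l • N x := by
      ext i j
      fin_cases i <;> fin_cases j <;> simp [posPart, hN]
      ring
    rw [e, add_mul, Matrix.mul_smul, Matrix.smul_mul, ← mul_assoc (P x), ← mul_assoc (P x),
      ← mul_assoc (P x), hPQ, one_mul, mul_assoc, mul_assoc]
  · simp only [Matrix.mul_apply, Fin.sum_univ_two]
    exact ((hCl x 0 j).const_mul _).add ((hCl x 1 j).const_mul _)
  · simp only [hC1, mul_one]
    refine ⟨?_, by simp [hP], fun i => ?_⟩
    · simp [hP, Matrix.det_fin_two, hδ0' x]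
    · have := hδ0 x
      fin_cases i <;> simp [hP, ← ofReal_inv, this]

theorem IsLaxFlow.laxMatrix_zero (h : IsLaxFlow a b c m k) (l : ℂ) :
    laxMatrix a b (m 0) (k 0) l = residue a b c l := by
  simp [laxMatrix, h.m_zero, h.k_zero]

variable {B : ℝ → ℂ → Mat2}

theorem IsPosSolution.hasEntryDerivAt_adjugate (hB : IsPosSolution a b m k B) (x : ℝ) (l : ℂ) :
    HasEntryDerivAt (fun t => (B t l).adjugate)
      (-((B x l).adjugate * posPart a b (m x) (k x) l)) x := by
  refine (hB.hasEntryDerivAt x l).adjugate.congr_deriv ?_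
  rw [Matrix.adjugate_mul_distrib, adjugate_eq_neg_of_trace_eq_zero (trace_posPart _ _ _), mul_neg]

/-- The positive factor conjugates the Delaunay residue into the Lax matrix. -/
theorem IsPosSolution.residue_mul_adjugate (hB : IsPosSolution a b m k B)
    (h : IsLaxFlow a b c m k) (x : ℝ) {l : ℂ} (hl : l ≠ 0) :
    residue a b c l * (B x l).adjugate = (B x l).adjugate * laxMatrix a b (m x) (k x) l := by
  have hconst : (B x l).adjugate * laxMatrix a b (m x) (k x) l * B x l = residue a b c l := by
    rw [eq_of_hasEntryDerivAt_zero (M := fun x =>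
      (B x l).adjugate * laxMatrix a b (m x) (k x) l * B x l) (fun t => ?_) x 0,
      hB.zero_left, h.laxMatrix_zero]
    · simp
    · refine (((hB.hasEntryDerivAt_adjugate t l).mul (h.hasEntryDerivAt_laxMatrix hl t)).mul
        (hB.hasEntryDerivAt t l)).congr_deriv ?_
      noncomm_ring
  rw [← hconst, mul_assoc, mul_adjugate_self (hB.det_eq_one x l), mul_one]

/-- Uniqueness of the inverse of the positive factor. -/
theorem IsPosSolution.eq_adjugate (hB : IsPosSolution a b m k B) {l : ℂ} {Z : ℝ → Mat2}
    (h0 : Z 0 = 1) (hZ : ∀ x, HasEntryDerivAt Z (-(Z x * posPart a b (m x) (k x) l)) x) (x : ℝ) :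
    Z x = (B x l).adjugate := by
  have h1 : Z x * B x l = 1 := by
    rw [eq_of_hasEntryDerivAt_zero (M := fun x => Z x * B x l) (fun t => ?_) x 0,
      hB.zero_left, h0, one_mul]
    refine ((hZ t).mul (hB.hasEntryDerivAt t l)).congr_deriv ?_
    noncomm_ring
  calc Z x = Z x * (B x l * (B x l).adjugate) := by
        rw [mul_adjugate_self (hB.det_eq_one x l), mul_one]
    _ = _ := by rw [← mul_assoc, h1, one_mul]

theorem conjTranspose_residue {l : ℂ} (hl : conj l = l⁻¹) :
    (residue a b c l)ᴴ = residue a b c l := by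
  ext i j
  fin_cases i <;> fin_cases j <;>
    simp [residue, Matrix.conjTranspose_apply, hl] <;> ring

/-- The factors `2` in `posPart` flip the sign of one summand in each off-diagonal entry of the
Hermitian Lax matrix, and its diagonal cancels; this makes the difference skew-Hermitian. -/
theorem conjTranspose_lax_sub_posPart (m k : ℝ) {l : ℂ} (hl : conj l = l⁻¹) :
    (laxMatrix a b m k l - posPart a b m k l)ᴴ = -(laxMatrix a b m k l - posPart a b m k l) := by
  rw [Matrix.conjTranspose_sub, laxMatrix, conjTranspose_residue hl]
  ext i j
  fin_cases i <;> fin_cases j <;>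
    simp [residue, posPart, Matrix.conjTranspose_apply, hl] <;> ring

/-- The unitary factor is unitary on the unit circle. -/
theorem IsPosSolution.exp_mul_adjugate_unitary (hB : IsPosSolution a b m k B)
    (h : IsLaxFlow a b c m k) (x y : ℝ) {l : ℂ} (hl0 : l ≠ 0) (hl : conj l = l⁻¹) :
    (NormedSpace.exp (((x : ℂ) + I * y) • residue a b c l) * (B x l).adjugate) *
      (NormedSpace.exp (((x : ℂ) + I * y) • residue a b c l) * (B x l).adjugate)ᴴ = 1 := by
  set A := residue a b c l with hA
  set U : ℝ → Mat2 := fun t => NormedSpace.exp ((t : ℂ) • A) * (B t l).adjugate with hU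
  have hUd : ∀ t, HasEntryDerivAt U
      (U t * (laxMatrix a b (m t) (k t) l - posPart a b (m t) (k t) l)) t := by
    intro t
    refine ((hasEntryDerivAt_exp_smul A (hasDerivAt_id t).ofReal_comp).mul
      (hB.hasEntryDerivAt_adjugate t l)).congr_deriv ?_
    simp only [id, ofReal_one, one_smul, exp_smul_mul_comm]
    rw [mul_assoc, hB.residue_mul_adjugate h t hl0, mul_sub, ← mul_assoc, mul_neg, ← mul_assoc,
      ← sub_eq_add_neg]
  have hUU : U x * (U x)ᴴ = 1 := by
    rw [eq_of_hasEntryDerivAt_zero (M := fun x => U x * (U x)ᴴ) (fun t => ?_) x 0]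
    · simp [hU, hB.zero_left]
    · refine ((hUd t).mul (hUd t).conjTranspose).congr_deriv ?_
      rw [Matrix.conjTranspose_mul (U t), conjTranspose_lax_sub_posPart _ _ hl]
      noncomm_ring
  -- `A` is Hermitian on the circle, so `y` contributes only a unitary factor on the left.
  have hexp : NormedSpace.exp ((I * y) • A) * (NormedSpace.exp ((I * y) • A))ᴴ = 1 := by
    rw [← Matrix.exp_conjTranspose, Matrix.conjTranspose_smul, hA, conjTranspose_residue hl,
      ← exp_smul_add]
    simp
  have hsplit : NormedSpace.exp (((x : ℂ) + I * y) • A) * (B x l).adjugate =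
      NormedSpace.exp ((I * y) • A) * U x := by
    rw [add_comm, exp_smul_add, hU, mul_assoc]
  rw [hsplit, Matrix.conjTranspose_mul, mul_assoc, ← mul_assoc (U x), hUU, one_mul, hexp]

end

section

/-! ### Uniqueness of the Iwasawa factorization -/

theorem row_norm_sq_eq_one {H : Mat2} (hH : H * Hᴴ = 1) (i : Fin 2) :
    ‖H i 0‖ ^ 2 + ‖H i 1‖ ^ 2 = 1 := by
  have h := congrFun (congrFun hH i) i
  simp only [Matrix.mul_apply, Fin.sum_univ_two, Matrix.conjTranspose_apply, Matrix.one_apply_eq,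
    RCLike.star_def, mul_conj'] at h
  exact_mod_cast h

theorem norm_diag_le_one {H : Mat2} (hH : H * Hᴴ = 1) (i : Fin 2) : ‖H i i‖ ≤ 1 := by
  have h := row_norm_sq_eq_one hH i
  rw [← sq_le_one_iff₀ (norm_nonneg _)]
  fin_cases i
  · simp only [Fin.zero_eta] at h ⊢
    nlinarith [sq_nonneg ‖H 0 1‖]
  · simp only [Fin.mk_one] at h ⊢
    nlinarith [sq_nonneg ‖H 1 0‖]

theorem eq_one_of_re_eq_one {z : ℂ} (h1 : ‖z‖ ≤ 1) (h2 : 1 ≤ z.re) : z = 1 := by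
  have h3 : z.re = 1 := le_antisymm ((re_le_norm z).trans h1) h2
  have h4 : ‖z‖ ^ 2 = z.re ^ 2 + z.im ^ 2 := by
    rw [← normSq_eq_norm_sq, normSq_apply]; ring
  have h5 : z.im ^ 2 ≤ 0 := by nlinarith [norm_nonneg z]
  exact Complex.ext (by simpa using h3) (by
    simpa using (pow_eq_zero_iff two_ne_zero).1 (le_antisymm h5 (sq_nonneg _)))

/-- A unitary matrix whose trace has real part at least two is the identity. -/
theorem eq_one_of_unitary_of_trace {H : Mat2} (hH : H * Hᴴ = 1) (h : 2 ≤ H.trace.re) : H = 1 := by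
  have n0 := norm_diag_le_one hH 0
  have n1 := norm_diag_le_one hH 1
  have r0 := (re_le_norm (H 0 0)).trans n0
  have r1 := (re_le_norm (H 1 1)).trans n1
  rw [Matrix.trace_fin_two, add_re] at h
  have e0 := eq_one_of_re_eq_one n0 (by linarith)
  have e1 := eq_one_of_re_eq_one n1 (by linarith)
  have q0 := row_norm_sq_eq_one hH 0
  have q1 := row_norm_sq_eq_one hH 1
  rw [e0] at q0
  rw [e1] at q1
  have o0 : H 0 1 = 0 := by simpa using q0
  have o1 : H 1 0 = 0 := by simpa using q1
  ext i j
  fin_cases i <;> fin_cases j <;> simp [e0, e1, o0, o1]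

/-- A holomorphic map from the disk to `2 × 2` matrices with unitary boundary values whose trace
at the centre has real part at least two is the identity on the circle. -/
theorem eq_one_of_unitary_boundary {H : ℂ → Mat2}
    (hd : ∀ i j, DiffContOnCl ℂ (fun l => H l i j) (Metric.ball 0 1))
    (hu : ∀ z : ℂ, ‖z‖ = 1 → H z * (H z)ᴴ = 1) (h0 : 2 ≤ (H 0).trace.re) {z : ℂ}
    (hz : ‖z‖ = 1) : H z = 1 := by
  have hdt : DiffContOnCl ℂ (fun l => (H l).trace) (Metric.ball 0 1) := by
    simp only [Matrix.trace_fin_two]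
    exact (hd 0 0).add (hd 1 1)
  have hbd : ∀ l : ℂ, ‖l‖ = 1 → ‖(H l).trace‖ ≤ 2 := by
    intro l hl
    rw [Matrix.trace_fin_two]
    exact (norm_add_le _ _).trans
      (by linarith [norm_diag_le_one (hu l hl) 0, norm_diag_le_one (hu l hl) 1])
  -- The trace is at most `2` in modulus on the boundary and at least `2` at the centre, so it
  -- attains its maximum inside and is constant.
  have hmax : IsMaxOn (norm ∘ fun l => (H l).trace) (Metric.ball 0 1) 0 := by
    intro l hl
    have h1 := norm_le_of_forall_mem_frontier_norm_le Metric.isBounded_ball hdt (C := 2)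
      (fun w hw => by
        rw [frontier_ball (0 : ℂ) one_ne_zero, mem_sphere_zero_iff_norm] at hw
        exact hbd w hw) (subset_closure hl)
    exact h1.trans (h0.trans (re_le_norm _))
  have heq := eqOn_closure_of_isPreconnected_of_isMaxOn_norm
    (convex_ball (0 : ℂ) 1).isPreconnected Metric.isOpen_ball hdt
    (Metric.mem_ball_self one_pos) hmax
  refine eq_one_of_unitary_of_trace (hu z hz) ?_
  have : (H z).trace = (H 0).trace := heq (by
    rw [closure_ball (0 : ℂ) one_ne_zero, mem_closedBall_zero_iff, hz])
  rwa [this]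

/-- The trace is a sum of two positive numbers whose product is `det P · det Q = 1`. -/
theorem two_le_trace_mul_adjugate {P Q : Mat2} (hP : IsPosUpperTriangular P)
    (hQ : IsPosUpperTriangular Q) : 2 ≤ (P * Q.adjugate).trace.re := by
  obtain ⟨dP, tP, pP⟩ := hP
  obtain ⟨dQ, tQ, pQ⟩ := hQ
  rw [Matrix.det_fin_two, tP, mul_zero, sub_zero] at dP
  rw [Matrix.det_fin_two, tQ, mul_zero, sub_zero] at dQ
  have hp := congrArg re dP
  have hq := congrArg re dQ
  simp only [mul_re, (pP 0).1, (pQ 0).1, zero_mul, sub_zero, one_re] at hp hq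
  rw [Matrix.trace_fin_two, Matrix.adjugate_fin_two]
  simp only [Matrix.mul_apply, Fin.sum_univ_two, tP, tQ]
  simp [mul_re, (pP 0).1, (pP 1).1, (pQ 0).1, (pQ 1).1]
  have h1 := mul_pos (pP 0).2 (pQ 1).2
  have h2 := mul_pos (pP 1).2 (pQ 0).2
  have h3 : ((P 0 0).re * (Q 1 1).re) * ((P 1 1).re * (Q 0 0).re) = 1 := by
    linear_combination ((Q 0 0).re * (Q 1 1).re) * hp + hq
  nlinarith [sq_nonneg ((P 0 0).re * (Q 1 1).re - (P 1 1).re * (Q 0 0).re)]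

/-- From `F B = F' B'` one gets `B' B⁻¹ = F'ᴴ F`: holomorphic in the disk on one side, unitary on
the circle on the other. -/
theorem IsIwasawa.unique {Φ F B F' B' : Circle → Mat2} (h : IsIwasawa Φ F B)
    (h' : IsIwasawa Φ F' B') : F' = F ∧ B' = B := by
  obtain ⟨Y, hYd, -, hYB, hY0⟩ := h.positive.extends_disk
  obtain ⟨Y', hYd', -, hYB', hY0'⟩ := h'.positive.extends_disk
  have hBdet := h.positive.isLoop.det_eq_one
  have hFu : ∀ z, F z * (F z)ᴴ = 1 := fun z => by
    rw [h.unitary.star_eq_inv, Matrix.mul_nonsing_inv _ (by simp [h.unitary.isLoop.det_eq_one z])]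
  have hFu' : ∀ z, (F' z)ᴴ * F' z = 1 := fun z => by
    rw [h'.unitary.star_eq_inv, Matrix.nonsing_inv_mul _ (by simp [h'.unitary.isLoop.det_eq_one z])]
  have hquot : ∀ z, B' z * (B z).adjugate = (F' z)ᴴ * F z := by
    intro z
    have e : F z * B z = F' z * B' z := (h.eq_mul z).symm.trans (h'.eq_mul z)
    calc B' z * (B z).adjugate = ((F' z)ᴴ * F' z) * B' z * (B z).adjugate := by
          rw [hFu', one_mul]
      _ = (F' z)ᴴ * (F' z * B' z) * (B z).adjugate := by simp only [mul_assoc]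
      _ = (F' z)ᴴ * F z * (B z * (B z).adjugate) := by rw [← e]; simp only [mul_assoc]
      _ = _ := by rw [mul_adjugate_self (hBdet z), mul_one]
  have hd : ∀ i j, DiffContOnCl ℂ (fun l => (Y' l * (Y l).adjugate) i j) (Metric.ball 0 1) := by
    intro i j
    have hadj : ∀ i j, DiffContOnCl ℂ (fun l => (Y l).adjugate i j) (Metric.ball 0 1) := by
      intro i j
      simp only [Matrix.adjugate_fin_two]
      fin_cases i <;> fin_cases j <;> simp
      · exact hYd 1 1
      · exact (hYd 0 1).neg
      · exact (hYd 1 0).neg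
      · exact hYd 0 0
    simp only [Matrix.mul_apply, Fin.sum_univ_two]
    exact ((hYd' i 0).smul (hadj 0 j)).add ((hYd' i 1).smul (hadj 1 j))
  have hone : ∀ z : Circle, B' z * (B z).adjugate = 1 := by
    intro z
    have := eq_one_of_unitary_boundary hd (fun w hw => ?_)
      (two_le_trace_mul_adjugate hY0' hY0) (Circle.norm_coe z)
    · rwa [hYB, hYB'] at this
    · obtain ⟨w, rfl⟩ : ∃ u : Circle, (u : ℂ) = w := ⟨⟨w, mem_sphere_zero_iff_norm.2 hw⟩, rfl⟩
      rw [hYB, hYB', hquot, Matrix.conjTranspose_mul, Matrix.conjTranspose_conjTranspose, mul_assoc,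
        ← mul_assoc (F _), hFu, one_mul, hFu']
  have hB : ∀ z, B' z = B z := by
    intro z
    calc B' z = B' z * ((B z).adjugate * B z) := by rw [adjugate_mul_self (hBdet z), mul_one]
      _ = B z := by rw [← mul_assoc, hone, one_mul]
  refine ⟨funext fun z => ?_, funext hB⟩
  calc F' z = F' z * ((F' z)ᴴ * F z) := by rw [← hquot, hone, mul_one]
    _ = F z := by rw [← mul_assoc, mul_eq_one_comm.1 (hFu' z), one_mul]

end

section

/-! ### Analyticity of parameter integrals -/

section PowerSeries

variable {E F : Type*} [NormedAddCommGroup E] [NormedSpace ℝ E] [NormedAddCommGroup F]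
  [NormedSpace ℝ F]

/-- The average of a power series over a family of linear substitutions. -/
noncomputable def averageSeries (p : FormalMultilinearSeries ℝ E F) (L : ℝ → E →L[ℝ] E) :
    FormalMultilinearSeries ℝ E F :=
  fun n => ∫ s in (0 : ℝ)..1, (p n).compContinuousLinearMap fun _ => L s

variable {p : FormalMultilinearSeries ℝ E F} {L : ℝ → E →L[ℝ] E}

theorem continuous_compContinuousLinearMap (hL : Continuous L) (n : ℕ) :
    Continuous fun s => (p n).compContinuousLinearMap fun _ => L s := by
  have h1 : Continuous fun s : ℝ => (fun _ : Fin n => L s) := by fun_prop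
  have h2 := (ContinuousMultilinearMap.compContinuousLinearMapContinuousMultilinear ℝ
    (fun _ : Fin n => E) (fun _ : Fin n => E) F).cont.comp h1
  exact h2.clm_apply continuous_const

theorem norm_compContinuousLinearMap_le_of_norm_le_one {A : E →L[ℝ] E} (hA : ‖A‖ ≤ 1) (n : ℕ) :
    ‖(p n).compContinuousLinearMap fun _ => A‖ ≤ ‖p n‖ := by
  refine ((p n).norm_compContinuousLinearMap_le _).trans ?_
  rw [Finset.prod_const]
  exact mul_le_of_le_one_right (norm_nonneg _) (pow_le_one₀ (norm_nonneg _) hA)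

theorem norm_averageSeries_le (hL : ∀ s ∈ Set.Icc (0 : ℝ) 1, ‖L s‖ ≤ 1) (n : ℕ) :
    ‖averageSeries p L n‖ ≤ ‖p n‖ := by
  have h := intervalIntegral.norm_integral_le_of_norm_le_const (a := (0 : ℝ)) (b := 1)
    (f := fun s => (p n).compContinuousLinearMap fun _ => L s) (C := ‖p n‖) fun s hs => by
      rw [Set.uIoc_of_le zero_le_one] at hs
      exact norm_compContinuousLinearMap_le_of_norm_le_one (hL s ⟨hs.1.le, hs.2⟩) n
  rw [averageSeries]
  simpa using h

/-- Contractions keep the substituted points in the ball and do not enlarge the coefficients, so the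
series may be integrated term by term with the same radius. -/
theorem hasFPowerSeriesOnBall_average [CompleteSpace F] {f : E → F} {z : E} {r : ENNReal}
    (hf : HasFPowerSeriesOnBall f p z r) (hL : Continuous L)
    (hL1 : ∀ s ∈ Set.Icc (0 : ℝ) 1, ‖L s‖ ≤ 1) :
    HasFPowerSeriesOnBall (fun y => ∫ s in (0 : ℝ)..1, f (z + L s (y - z))) (averageSeries p L)
      z r := by
  refine ⟨?_, hf.r_pos, fun {y} hy => ?_⟩
  · refine ENNReal.le_of_forall_nnreal_lt fun t ht => ?_
    obtain ⟨C, -, hC⟩ := p.norm_mul_pow_le_of_lt_radius (ht.trans_le hf.r_le)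
    refine FormalMultilinearSeries.le_radius_of_bound _ C fun n => ?_
    exact (mul_le_mul_of_nonneg_right (norm_averageSeries_le hL1 n) (by positivity)).trans (hC n)
  · have hle : ∀ s ∈ Set.Icc (0 : ℝ) 1, ‖L s y‖ ≤ ‖y‖ := fun s hs =>
      ((L s).le_opNorm y).trans (mul_le_of_le_one_left (norm_nonneg _) (hL1 s hs))
    have hmem : ∀ s ∈ Set.Icc (0 : ℝ) 1, L s y ∈ Metric.eball (0 : E) r := by
      intro s hs
      rw [mem_eball_zero_iff] at hy ⊢
      refine lt_of_le_of_lt ?_ hy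
      rw [← ofReal_norm, ← ofReal_norm]
      exact ENNReal.ofReal_le_ofReal (hle s hs)
    have happ : ∀ n, averageSeries p L n (fun _ => y) =
        ∫ s in (0 : ℝ)..1, p n fun _ => L s y := by
      intro n
      have h1 := (ContinuousMultilinearMap.apply ℝ (fun _ : Fin n => E) F
        fun _ => y).intervalIntegral_comp_comm
        ((continuous_compContinuousLinearMap (p := p) hL n).intervalIntegrable
          (μ := MeasureTheory.volume) 0 1)
      exact h1.symm
    simp only [happ, add_sub_cancel_left]
    have hsum : Summable fun n => ‖p n‖ * ‖y‖ ^ n := by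
      have hy' : (‖y‖₊ : ENNReal) < p.radius := by
        rw [mem_eball_zero_iff] at hy
        exact hy.trans_le hf.r_le
      simpa using p.summable_norm_mul_pow hy'
    refine intervalIntegral.hasSum_integral_of_dominated_convergence
      (fun n _ => ‖p n‖ * ‖y‖ ^ n) (fun n => ?_) (fun n => Filter.Eventually.of_forall fun s hs => ?_)
      (Filter.Eventually.of_forall fun _ _ => hsum) intervalIntegrable_const
      (Filter.Eventually.of_forall fun s hs => ?_)
    · have : Continuous fun s => p n fun _ => L s y :=
        (p n).cont.comp (continuous_pi fun _ => hL.clm_apply continuous_const)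
      exact this.aestronglyMeasurable
    · rw [Set.uIoc_of_le zero_le_one] at hs
      refine ((p n).le_opNorm _).trans ?_
      rw [Finset.prod_const, Finset.card_univ, Fintype.card_fin]
      have := hle s ⟨hs.1.le, hs.2⟩
      gcongr
    · rw [Set.uIoc_of_le zero_le_one] at hs
      exact hf.hasSum (hmem s ⟨hs.1.le, hs.2⟩)

/-- The primitive in the first variable of a function that is analytic in two variables is
analytic in both variables. -/
theorem analyticAt_primitive [CompleteSpace F] {f : ℝ × E → F} {x₀ : ℝ} {y₀ : E}
    (hf : AnalyticAt ℝ f (x₀, y₀)) :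
    AnalyticAt ℝ (fun q : ℝ × E => ∫ t in x₀..q.1, f (t, q.2)) (x₀, y₀) := by
  obtain ⟨p, r, hp⟩ := hf
  -- The primitive is `(x - x₀) ∫₀¹ f(x₀ + s(x - x₀), y) ds`, an average over the contractions `(x,
  -- y) ↦ (sx, y)` about `(x₀, y₀)`.
  set L : ℝ → (ℝ × E) →L[ℝ] (ℝ × E) := fun s =>
    s • (ContinuousLinearMap.inl ℝ ℝ E).comp (ContinuousLinearMap.fst ℝ ℝ E) +
      (ContinuousLinearMap.inr ℝ ℝ E).comp (ContinuousLinearMap.snd ℝ ℝ E) with hL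
  have hLa : ∀ s (q : ℝ × E), L s q = (s * q.1, q.2) := by
    intro s q; simp [hL]
  have hLc : Continuous L := by fun_prop
  have hL1 : ∀ s ∈ Set.Icc (0 : ℝ) 1, ‖L s‖ ≤ 1 := by
    intro s hs
    refine ContinuousLinearMap.opNorm_le_bound _ zero_le_one fun q => ?_
    rw [hLa, one_mul, Prod.norm_def, Prod.norm_def]
    refine max_le_max ?_ le_rfl
    rw [norm_mul, Real.norm_of_nonneg hs.1]
    exact mul_le_of_le_one_left (norm_nonneg _) hs.2
  have h := (hasFPowerSeriesOnBall_average hp hLc hL1).analyticAt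
  have hfst : AnalyticAt ℝ (fun q : ℝ × E => q.1 - x₀) (x₀, y₀) :=
    analyticAt_fst.sub analyticAt_const
  refine (hfst.smul h).congr (Filter.Eventually.of_forall fun q => ?_)
  change (q.1 - x₀) • ∫ s in (0 : ℝ)..1, f ((x₀, y₀) + L s (q - (x₀, y₀))) =
    ∫ t in x₀..q.1, f (t, q.2)
  have h2 := intervalIntegral.smul_integral_comp_add_mul (a := (0 : ℝ)) (b := 1)
    (fun t => f (t, q.2)) (q.1 - x₀) x₀
  rw [mul_zero, mul_one, add_zero, add_sub_cancel] at h2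
  rw [← h2]
  simp only [hLa, Prod.fst_sub, Prod.snd_sub, Prod.mk_add_mk, add_sub_cancel]
  congr 2
  funext s
  rw [mul_comm]

end PowerSeries

/-! ### The cut -/

variable {a b : ℂ} {c α β : ℝ} {v : ℝ → ℝ}

/-- With `p = -ab / |ab|` the zeros of `det A` are `(β/α) p` and `(α/β) p`, while the equation for
`l` gives `l = (τ / 4|ab|) p`. As `αβ = 4|ab|`, the interval `[β², α²]` for `τ` corresponds exactly
to the cut. -/
theorem IsTurning.mem_cut (ha : a ≠ 0) (hb : b ≠ 0) (ht : IsTurning a b c α β) {l : ℂ} {τ : ℝ}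
    (hτ : τ ∈ Set.Icc (β ^ 2) (α ^ 2)) (h : 4 * conj a * conj b * l + τ = 0) :
    l ∈ cut a b c := by
  have hβ := ht.pos
  have hα : 0 < α := hβ.trans_le ht.le
  set n := ‖a * b‖ with hn
  have hn0 : 0 < n := norm_pos_iff.2 (mul_ne_zero ha hb)
  have hnC : (n : ℂ) ≠ 0 := by exact_mod_cast hn0.ne'
  have hαC : (α : ℂ) ≠ 0 := by exact_mod_cast hα.ne'
  have hβC : (β : ℂ) ≠ 0 := by exact_mod_cast hβ.ne'
  have hca : conj a ≠ 0 := by simpa using ha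
  have hcb : conj b ≠ 0 := by simpa using hb
  have hsq : (n : ℂ) ^ 2 = conj a * conj b * (a * b) := by
    rw [hn, ← conj_mul', map_mul]
  have hmul : (α : ℂ) * β = 4 * n := by exact_mod_cast ht.mul_eq
  have hsum : (α : ℂ) ^ 2 + β ^ 2 = 4 * (conj a * a + conj b * b + c ^ 2) := by
    have := congrArg (fun t : ℝ => (t : ℂ)) ht.sq_add_sq
    push_cast at this
    rwa [norm_sq_eq, norm_sq_eq] at this
  set p : ℂ := -(a * b) / n with hp
  have hpn : ‖p‖ = 1 := by
    rw [hp, norm_div, norm_neg, norm_real, Real.norm_of_nonneg hn0.le]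
    exact div_self hn0.ne'
  have hs0 : 0 < β / α := by positivity
  have hs1 : β / α ≤ 1 := (div_le_one hα).2 ht.le
  have hs2 : 1 ≤ α / β := (one_le_div hβ).2 ht.le
  have hnorm : ∀ s : ℝ, 0 ≤ s → ‖(s : ℂ) * p‖ = s := by
    intro s hs
    rw [norm_mul, hpn, mul_one, norm_real, Real.norm_of_nonneg hs]
  have hp0 : p ≠ 0 := norm_ne_zero_iff.1 (by rw [hpn]; exact one_ne_zero)
  refine ⟨(β / α : ℝ) * p, (α / β : ℝ) * p, p, τ / (4 * n), ?_, ?_, hpn, ?_, ?_, ?_, ?_⟩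
  · ext w
    simp only [zeros, Set.mem_ofPred_eq, Set.mem_insert_iff, Set.mem_singleton_iff]
    have hkey : w ≠ 0 → -w * (residue a b c w).det =
        (conj a * conj b) * ((w - (β / α : ℝ) * p) * (w - (α / β : ℝ) * p)) := by
      intro hw
      have e1 : ((w - (β / α : ℝ) * p) * (w - (α / β : ℝ) * p)) =
          w ^ 2 - ((α : ℂ) ^ 2 + β ^ 2) / (α * β) * (p * w) + p ^ 2 := by
        push_cast
        field_simp
        ring
      rw [e1, hsum, hmul, hp, Matrix.det_fin_two]
      simp only [residue, Matrix.of_apply, Matrix.cons_val', Matrix.cons_val_zero,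
        Matrix.cons_val_one, Matrix.cons_val_fin_one]
      field_simp
      rw [hsq]
      ring
    constructor
    · rintro ⟨hw, hdet⟩
      have h1 := hkey hw
      rw [hdet, mul_zero] at h1
      have h2 := (mul_eq_zero.1 h1.symm).resolve_left (mul_ne_zero hca hcb)
      rcases mul_eq_zero.1 h2 with h3 | h3
      · exact Or.inl (sub_eq_zero.1 h3)
      · exact Or.inr (sub_eq_zero.1 h3)
    · intro hw
      have hw0 : w ≠ 0 := by
        rcases hw with rfl | rfl
        · exact mul_ne_zero (by exact_mod_cast hs0.ne') hp0
        · exact mul_ne_zero (by exact_mod_cast (one_pos.trans_le hs2).ne') hp0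
      refine ⟨hw0, ?_⟩
      have h1 := hkey hw0
      have h2 : (w - (β / α : ℝ) * p) * (w - (α / β : ℝ) * p) = 0 := by
        rcases hw with h | h
        · rw [h]; simp
        · rw [h]; simp
      rw [h2, mul_zero] at h1
      exact (mul_eq_zero.1 h1).resolve_left (neg_ne_zero.2 hw0)
  · rw [hnorm _ hs0.le, hnorm _ (by positivity)]
    exact hs1.trans hs2
  · have h1 : (1 : ℝ) ∈ segment ℝ (β / α) (α / β) := by
      rw [segment_eq_Icc (hs1.trans hs2)]; exact ⟨hs1, hs2⟩
    obtain ⟨u, w, hu, hw, huw, e⟩ := h1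
    refine ⟨u, w, hu, hw, huw, ?_⟩
    have e' := congrArg (fun t : ℝ => (t : ℂ)) e
    simp only [smul_eq_mul, ofReal_add, ofReal_mul, ofReal_one] at e'
    simp only [real_smul]
    linear_combination p * e'
  · rw [hnorm _ hs0.le, ← ht.mul_eq, div_le_div_iff₀ hα (by positivity)]
    nlinarith [hτ.1]
  · rw [hnorm _ (by positivity), ← ht.mul_eq, div_le_div_iff₀ (by positivity) hβ]
    nlinarith [hτ.2]
  · have h1 : l = -τ / (4 * (conj a * conj b)) := by
      field_simp
      linear_combination h
    rw [h1, hp]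
    push_cast
    field_simp
    rw [hsq]
    field_simp

/-- Off the cut the denominators of the elliptic integrals are locally bounded away from zero. -/
theorem IsTurning.exists_norm_ge (ha : a ≠ 0) (hb : b ≠ 0) (ht : IsTurning a b c α β) {l₀ : ℂ}
    (hl : l₀ ∉ cut a b c) :
    ∃ δ : ℝ, 0 < δ ∧ ∀ᶠ l in nhds l₀, ∀ τ ∈ Set.Icc (β ^ 2) (α ^ 2),
      δ ≤ ‖4 * conj a * conj b * l + (τ : ℝ)‖ := by
  have hle : β ^ 2 ≤ α ^ 2 := by have := ht.pos.le; have := ht.le; gcongr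
  have hcont : Continuous fun τ : ℝ => ‖4 * conj a * conj b * l₀ + (τ : ℝ)‖ := by fun_prop
  obtain ⟨τ₀, hτ₀, hmin⟩ := (isCompact_Icc (a := β ^ 2) (b := α ^ 2)).exists_isMinOn
    (Set.nonempty_Icc.2 hle) hcont.continuousOn
  set δ := ‖4 * conj a * conj b * l₀ + (τ₀ : ℝ)‖ with hδ
  have hδ0 : 0 < δ := norm_pos_iff.2 fun h => hl (ht.mem_cut ha hb hτ₀ h)
  refine ⟨δ / 2, by positivity, ?_⟩
  have hcl : Continuous fun l : ℂ => ‖4 * conj a * conj b * (l - l₀)‖ := by fun_prop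
  have hev : ∀ᶠ l in nhds l₀, ‖4 * conj a * conj b * (l - l₀)‖ < δ / 2 :=
    hcl.continuousAt.eventually_lt_const (by simpa using hδ0)
  filter_upwards [hev] with l h τ hτ
  have h1 : δ ≤ ‖4 * conj a * conj b * l₀ + (τ : ℝ)‖ := hmin hτ
  have h2 : 4 * conj a * conj b * l₀ + (τ : ℝ) =
    (4 * conj a * conj b * l + (τ : ℝ)) - 4 * conj a * conj b * (l - l₀) := by ring
  have h3 := norm_sub_le (4 * conj a * conj b * l + (τ : ℝ)) (4 * conj a * conj b * (l - l₀))
  rw [← h2] at h3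
  linarith

end

section

/-! ### The elliptic integral of the third kind -/

/-- The elliptic integral `psi`, divided by the spectral parameter. -/
noncomputable def psiQuot (a b : ℂ) (v : ℝ → ℝ) (x : ℝ) (l : ℂ) : ℂ :=
  ∫ t in (0 : ℝ)..x, 8 * conj a * conj b / (4 * conj a * conj b * l + (v t : ℂ) ^ 2)

variable {a b : ℂ} {c α β : ℝ} {v m k : ℝ → ℝ}

/-- With `scaledResidue_eq` this rewrites `ψA` as a product of two factors regular at `l = 0`. -/
theorem psi_eq_mul_psiQuot (ha : a ≠ 0) (hb : b ≠ 0) (x : ℝ) {l : ℂ} (hl : l ≠ 0) :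
    psi a b v x l = l * psiQuot a b v x l := by
  have ha' : conj a ≠ 0 := by simpa using ha
  have hb' : conj b ≠ 0 := by simpa using hb
  rw [psi, psiQuot, ← intervalIntegral.integral_const_mul]
  congr 1
  funext t
  have h : (1 + (4 * conj a * conj b * l)⁻¹ * (v t : ℂ) ^ 2) =
      (4 * conj a * conj b * l + (v t : ℂ) ^ 2) / (4 * conj a * conj b * l) := by
    field_simp
  rw [h, div_div_eq_mul_div]
  ring

theorem IsProfile.continuous (hv : IsProfile a b c v) : Continuous v :=
  continuous_iff_continuousAt.2 fun x => (hv.hasDerivAt x).continuousAt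

theorem IsProfile.exists_norm_ge (ha : a ≠ 0) (hb : b ≠ 0) (hv : IsProfile a b c v)
    (ht : IsTurning a b c α β) {l₀ : ℂ} (hl : l₀ ∉ cut a b c) :
    ∃ δ : ℝ, 0 < δ ∧ ∀ᶠ l in nhds l₀, ∀ t,
      δ ≤ ‖4 * conj a * conj b * l + (v t : ℂ) ^ 2‖ := by
  obtain ⟨δ, hδ, h⟩ := ht.exists_norm_ge ha hb hl
  refine ⟨δ, hδ, ?_⟩
  filter_upwards [h] with l hl t
  have := hl (v t ^ 2) (hv.sq_mem_Icc ht t)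
  rwa [ofReal_pow] at this

theorem continuous_psi_integrand (hv : Continuous v) {δ : ℝ} (hδ : 0 < δ) {l : ℂ}
    (h : ∀ t, δ ≤ ‖4 * conj a * conj b * l + (v t : ℂ) ^ 2‖) :
    Continuous fun t => 8 * conj a * conj b / (4 * conj a * conj b * l + (v t : ℂ) ^ 2) :=
  continuous_const.div (by fun_prop) fun t => norm_pos_iff.1 (hδ.trans_le (h t))

theorem hasDerivAt_psiQuot (hv : Continuous v) {δ : ℝ} (hδ : 0 < δ) {l : ℂ}
    (h : ∀ t, δ ≤ ‖4 * conj a * conj b * l + (v t : ℂ) ^ 2‖) (x : ℝ) :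
    HasDerivAt (fun x => psiQuot a b v x l)
      (8 * conj a * conj b / (4 * conj a * conj b * l + (v x : ℂ) ^ 2)) x := by
  have hc := continuous_psi_integrand hv hδ h
  exact intervalIntegral.integral_hasDerivAt_right (hc.intervalIntegrable _ _)
    (hc.stronglyMeasurableAtFilter _ _) hc.continuousAt

theorem psiQuot_add_period {ρ : ℝ} (hρ : Function.Periodic v ρ) (hv : Continuous v) {δ : ℝ}
    (hδ : 0 < δ) {l : ℂ} (h : ∀ t, δ ≤ ‖4 * conj a * conj b * l + (v t : ℂ) ^ 2‖) (x : ℝ) :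
    psiQuot a b v (x + ρ) l = psiQuot a b v x l + psiQuot a b v ρ l := by
  have hc := continuous_psi_integrand hv hδ h
  have hper : Function.Periodic
      (fun t => 8 * conj a * conj b / (4 * conj a * conj b * l + (v t : ℂ) ^ 2)) ρ :=
    fun t => by simp only [hρ t]
  have h1 := hper.intervalIntegral_add_eq x 0
  rw [zero_add] at h1
  simp only [psiQuot]
  rw [← h1, intervalIntegral.integral_add_adjacent_intervals (hc.intervalIntegrable _ _)
    (hc.intervalIntegrable _ _)]

theorem differentiableAt_psiQuot (hv : Continuous v) {δ : ℝ} (hδ : 0 < δ) {l₀ : ℂ}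
    (h : ∀ᶠ l in nhds l₀, ∀ t, δ ≤ ‖4 * conj a * conj b * l + (v t : ℂ) ^ 2‖) (x : ℝ) :
    DifferentiableAt ℂ (psiQuot a b v x) l₀ := by
  have hcont := fun l hl => continuous_psi_integrand (a := a) (b := b) (l := l) hv hδ hl
  have key := intervalIntegral.hasDerivAt_integral_of_dominated_loc_of_deriv_le
    (μ := MeasureTheory.volume) (a := 0) (b := x)
    (F := fun l t => 8 * conj a * conj b / (4 * conj a * conj b * l + (v t : ℂ) ^ 2))
    (F' := fun l t => -(8 * conj a * conj b * (4 * conj a * conj b)) /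
      (4 * conj a * conj b * l + (v t : ℂ) ^ 2) ^ 2)
    (bound := fun _ => ‖-(8 * conj a * conj b * (4 * conj a * conj b))‖ / δ ^ 2) h
    (by
      filter_upwards [h] with l hl
      exact (hcont l hl).aestronglyMeasurable)
    ((hcont l₀ h.self_of_nhds).intervalIntegrable _ _)
    (by
      have : Continuous fun t => -(8 * conj a * conj b * (4 * conj a * conj b)) /
          (4 * conj a * conj b * l₀ + (v t : ℂ) ^ 2) ^ 2 :=
        continuous_const.div (by fun_prop) fun t =>
          pow_ne_zero 2 (norm_pos_iff.1 (hδ.trans_le (h.self_of_nhds t)))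
      exact this.aestronglyMeasurable)
    (Filter.Eventually.of_forall fun t _ l hl => by
      rw [norm_div, norm_pow]
      have := hl t
      gcongr)
    intervalIntegrable_const
    (Filter.Eventually.of_forall fun t _ l hl => by
      have h0 : 4 * conj a * conj b * l + (v t : ℂ) ^ 2 ≠ 0 :=
        norm_pos_iff.1 (hδ.trans_le (hl t))
      refine ((hasDerivAt_const l (8 * conj a * conj b)).div
        (((hasDerivAt_id l).const_mul (4 * conj a * conj b)).add_const _) h0).congr_deriv ?_
      simp)
  exact key.2.differentiableAt

theorem analyticAt_psiQuot_param (hv : Continuous v) {δ : ℝ} (hδ : 0 < δ) {l₀ : ℂ}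
    (h : ∀ᶠ l in nhds l₀, ∀ t, δ ≤ ‖4 * conj a * conj b * l + (v t : ℂ) ^ 2‖) (x : ℝ) :
    AnalyticAt ℂ (psiQuot a b v x) l₀ := by
  rw [analyticAt_iff_eventually_differentiableAt]
  filter_upwards [eventually_eventually_nhds.2 h] with l hl
  exact differentiableAt_psiQuot hv hδ hl x

/-- A real analytic function of the first variable, as a function of both variables. -/
theorem analyticAt_ofReal_fst {f : ℝ → ℝ} {q : ℝ × ℂ} (hf : AnalyticAt ℝ f q.1) :
    AnalyticAt ℝ (fun p : ℝ × ℂ => (f p.1 : ℂ)) q :=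
  (ofRealCLM.analyticAt _).comp_of_eq (hf.comp_of_eq analyticAt_fst rfl) rfl

/-- The integral is split at `x₀`: the part up to `x₀` is holomorphic in `l` alone, and the rest is
a local primitive of a jointly analytic function. -/
theorem analyticAt_psiQuot (hv : AnalyticOnNhd ℝ v Set.univ) (hvc : Continuous v) {δ : ℝ}
    (hδ : 0 < δ) {x₀ : ℝ} {l₀ : ℂ}
    (h : ∀ᶠ l in nhds l₀, ∀ t, δ ≤ ‖4 * conj a * conj b * l + (v t : ℂ) ^ 2‖) :
    AnalyticAt ℝ (fun q : ℝ × ℂ => psiQuot a b v q.1 q.2) (x₀, l₀) := by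
  have h0 : 4 * conj a * conj b * l₀ + (v x₀ : ℂ) ^ 2 ≠ 0 :=
    norm_pos_iff.1 (hδ.trans_le (h.self_of_nhds x₀))
  have hvq : AnalyticAt ℝ (fun q : ℝ × ℂ => (v q.1 : ℂ)) (x₀, l₀) :=
    analyticAt_ofReal_fst (hv x₀ trivial)
  have h1 : AnalyticAt ℝ (fun q : ℝ × ℂ =>
      8 * conj a * conj b / (4 * conj a * conj b * q.2 + (v q.1 : ℂ) ^ 2)) (x₀, l₀) :=
    analyticAt_const.div ((analyticAt_const.mul analyticAt_snd).add (hvq.pow 2)) h0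
  have h2 : AnalyticAt ℝ (fun q : ℝ × ℂ => psiQuot a b v x₀ q.2) (x₀, l₀) :=
    ((analyticAt_psiQuot_param hvc hδ h x₀).restrictScalars (𝕜 := ℝ)).comp_of_eq
      analyticAt_snd rfl
  refine (h2.add (analyticAt_primitive h1)).congr ?_
  filter_upwards [continuousAt_snd.eventually h] with q hq
  have hc := continuous_psi_integrand hvc hδ hq
  exact intervalIntegral.integral_add_adjacent_intervals (hc.intervalIntegrable _ _)
    (hc.intervalIntegrable _ _)

/-! ### The gauge -/

/-- The product of the spectral parameter and the Delaunay residue. -/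
def scaledResidue (a b : ℂ) (c : ℝ) (l : ℂ) : Mat2 :=
  !![c * l, a + conj b * l; b * l + conj a * l ^ 2, -(c * l)]

theorem scaledResidue_eq {l : ℂ} (hl : l ≠ 0) : scaledResidue a b c l = l • residue a b c l := by
  ext i j
  fin_cases i <;> fin_cases j <;> simp [scaledResidue, residue] <;> field_simp

theorem trace_scaledResidue (l : ℂ) : (scaledResidue a b c l).trace = 0 := by
  simp [scaledResidue, Matrix.trace_fin_two]

/-- The denominator of the elliptic integral in terms of the scale `M = v / (2 * ‖b‖)`. -/
def den (a b M l : ℂ) : ℂ := 4 * conj a * conj b * l + 4 * conj b * b * M ^ 2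

/-- The diagonal entry of the gauge. -/
noncomputable def gaugeDiag (a b M l : ℂ) : ℂ :=
  -- A square root of `den M / (den 1 · M)`, equal to `1` at `M = 1` where `den 1 ≠ 0`, and never
  -- zero.
  exp ((log (den a b M l / den a b 1 l) - log M) / 2)

/-- The upper triangular gauge between the Delaunay residue and the Lax matrix. -/
noncomputable def gauge (a b : ℂ) (c : ℝ) (M K l : ℂ) : Mat2 :=
  !![gaugeDiag a b M l, gaugeDiag a b M l * ((c - K) * (4 * conj b * M)) / den a b M l;
    0, (gaugeDiag a b M l)⁻¹]

theorem gaugeDiag_ne_zero (M l : ℂ) : gaugeDiag a b M l ≠ 0 := exp_ne_zero _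

theorem det_gauge (M K l : ℂ) : (gauge a b c M K l).det = 1 := by
  simp [gauge, Matrix.det_fin_two, gaugeDiag_ne_zero]

theorem gaugeDiag_sq {M l : ℂ} (hM : M ≠ 0) (h : den a b M l / den a b 1 l ≠ 0) :
    gaugeDiag a b M l ^ 2 = den a b M l / den a b 1 l / M := by
  rw [gaugeDiag, ← exp_nat_mul]
  push_cast
  rw [mul_div_cancel₀ _ two_ne_zero, exp_sub, exp_log h, exp_log hM]

theorem analyticAt_gauge {𝕜 E : Type*} [RCLike 𝕜] [NormedAlgebra 𝕜 ℂ] [NormedAddCommGroup E]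
    [NormedSpace 𝕜 E] {M K l : E → ℂ} {q : E} (hM : AnalyticAt 𝕜 M q) (hK : AnalyticAt 𝕜 K q)
    (hl : AnalyticAt 𝕜 l q) (hMs : M q ∈ slitPlane)
    (hs : den a b (M q) (l q) / den a b 1 (l q) ∈ slitPlane) (i j : Fin 2) :
    AnalyticAt 𝕜 (fun p => gauge a b c (M p) (K p) (l p) i j) q := by
  have hne := slitPlane_ne_zero hs
  have hd1 : den a b 1 (l q) ≠ 0 := fun h => hne (by rw [h, div_zero])
  have hd : den a b (M q) (l q) ≠ 0 := fun h => hne (by rw [h, zero_div])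
  have hden : ∀ N : E → ℂ, AnalyticAt 𝕜 N q → AnalyticAt 𝕜 (fun p => den a b (N p) (l p)) q :=
    fun N hN => (analyticAt_const.mul hl).add (analyticAt_const.mul (hN.pow 2))
  have hdM := hden M hM
  have hd1' := hden (fun _ => 1) analyticAt_const
  have hlog : ∀ {f : E → ℂ}, AnalyticAt 𝕜 f q → f q ∈ slitPlane →
      AnalyticAt 𝕜 (fun p => log (f p)) q := fun hf h =>
    ((analyticAt_clog h).restrictScalars (𝕜 := 𝕜)).comp hf
  have hg : AnalyticAt 𝕜 (fun p => gaugeDiag a b (M p) (l p)) q := by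
    have h1 : AnalyticAt 𝕜 (fun p => (log (den a b (M p) (l p) / den a b 1 (l p)) -
        log (M p)) / 2) q :=
      (((hlog (hdM.div hd1' hd1) hs).sub (hlog hM hMs))).div analyticAt_const two_ne_zero
    exact AnalyticAt.comp (g := exp) (analyticAt_cexp.restrictScalars (𝕜 := 𝕜)) h1
  fin_cases i <;> fin_cases j <;> simp [gauge]
  · exact hg
  · exact (hg.mul ((analyticAt_const.sub hK).mul (analyticAt_const.mul hM))).div hdM hd
  · exact analyticAt_const
  · exact hg.inv (gaugeDiag_ne_zero _ _)

theorem IsLaxFlow.hasDerivAt_gaugeDiag (h : IsLaxFlow a b c m k) {l : ℂ} {x : ℝ}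
    (hs : den a b (m x) l / den a b 1 l ∈ slitPlane) :
    HasDerivAt (fun t => gaugeDiag a b (m t) l)
      (gaugeDiag a b (m x) l * (k x * (l * (8 * conj a * conj b / den a b (m x) l) - 1))) x := by
  have hne := slitPlane_ne_zero hs
  have hd1 : den a b 1 l ≠ 0 := fun h => hne (by rw [h, div_zero])
  have hd : den a b (m x) l ≠ 0 := fun h => hne (by rw [h, zero_div])
  have hm0 := h.ne_zero x
  have hm := h.hasDerivAt_m' x
  have hden : HasDerivAt (fun t => den a b (m t) l) _ x :=
    ((hm.pow 2).const_mul (4 * conj b * b)).const_add (4 * conj a * conj b * l)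
  have hms : (m x : ℂ) ∈ slitPlane := ofReal_mem_slitPlane.2 (h.pos x)
  have h1 := ((((hden.div_const (den a b 1 l)).clog_real hs).sub (hm.clog_real hms)).div_const
    2).cexp
  refine HasDerivAt.congr_deriv h1 ?_
  rw [gaugeDiag]
  simp only [Pi.sub_apply]
  congr 1
  have e : (8 : ℂ) * conj a * conj b * l = 2 * den a b (m x) l - 8 * conj b * b * m x ^ 2 := by
    rw [den]; ring
  have e2 : l * (8 * conj a * conj b / den a b (m x) l) =
      2 - 8 * conj b * b * m x ^ 2 / den a b (m x) l := by
    rw [eq_sub_iff_add_eq]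
    field_simp
    linear_combination e
  rw [e2]
  simp only [Nat.cast_ofNat, Nat.reduceSub, pow_one]
  field_simp
  ring

/-- The scalar in front is the derivative of `psiQuot`, so this is the equation `G' = ψ' A G - G P`
that makes `exp(-ψA) G` solve the equation of the inverse positive factor. -/
theorem IsLaxFlow.hasEntryDerivAt_gauge (hb : b ≠ 0) (h : IsLaxFlow a b c m k) {l : ℂ} {x : ℝ}
    (hs : den a b (m x) l / den a b 1 l ∈ slitPlane) :
    HasEntryDerivAt (fun t => gauge a b c (m t) (k t) l)
      ((8 * conj a * conj b / den a b (m x) l) •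
        (scaledResidue a b c l * gauge a b c (m x) (k x) l) -
        gauge a b c (m x) (k x) l * posPart a b (m x) (k x) l) x := by
  have hne := slitPlane_ne_zero hs
  have hd1 : den a b 1 l ≠ 0 := fun h => hne (by rw [h, div_zero])
  have hd : den a b (m x) l ≠ 0 := fun h => hne (by rw [h, zero_div])
  have hm0 := h.ne_zero x
  have hcb : conj b ≠ 0 := by simpa using hb
  have hg := h.hasDerivAt_gaugeDiag hs
  have hg0 : gaugeDiag a b (m x) l ≠ 0 := gaugeDiag_ne_zero _ _
  have hgsq := gaugeDiag_sq hm0 hne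
  have hk := h.hasDerivAt_k' x
  have hm := h.hasDerivAt_m' x
  have hen := h.energy' x
  have hden : HasDerivAt (fun t => den a b (m t) l) _ x :=
    ((hm.pow 2).const_mul (4 * conj b * b)).const_add (4 * conj a * conj b * l)
  simp only [Nat.cast_ofNat, Nat.reduceSub, pow_one] at hden
  -- The inverse of the square root is a rational multiple of it, so every entry becomes `gaugeDiag`
  -- times a rational function.
  have hginv : (gaugeDiag a b (m x) l)⁻¹ =
      gaugeDiag a b (m x) l * (den a b 1 l * m x) / den a b (m x) l := by
    have h1 : gaugeDiag a b (m x) l ^ 2 * (den a b 1 l * m x) = den a b (m x) l := by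
      rw [hgsq]; field_simp
    rw [inv_eq_iff_eq_inv, inv_div, eq_div_iff (by positivity)]
    linear_combination h1
  have e1 : den a b 1 l = 4 * conj b * (b + conj a * l) := by rw [den]; ring
  -- The upper right entry with denominators cleared; it is the only entry that needs the conserved
  -- energy.
  have key : k x * (8 * conj a * conj b * l - den a b (m x) l) * (c - k x) * (4 * conj b * m x) +
      (-(2 * (conj b * b * m x ^ 2 - conj a * a * (m x : ℂ)⁻¹ ^ 2)) * (4 * conj b * m x) -
        8 * (c - k x) * conj b * k x * m x) * den a b (m x) l +
      64 * (c - k x) * conj b ^ 2 * b * k x * m x ^ 3 =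
      8 * conj a * conj b * (c * l * (c - k x) * (4 * conj b * m x) +
        (a + conj b * l) * (den a b 1 l * m x)) - den a b (m x) l ^ 2 * (2 * conj b * m x) +
        4 * den a b (m x) l * (c - k x) * conj b * m x * k x := by
    rw [e1, den]
    linear_combination (32 * conj a * conj b ^ 2 * l * m x) * hen +
      (32 * conj a * a * conj b ^ 2 * b * m x * (m x * (m x : ℂ)⁻¹ + 1)) * mul_inv_cancel₀ hm0
  intro i j
  fin_cases i <;> fin_cases j <;> simp [gauge, scaledResidue, posPart]
  · refine hg.congr_deriv ?_
    field_simp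
    ring
  · refine ((hg.mul ((hk.const_sub (c : ℂ)).mul (hm.const_mul (4 * conj b)))).div hden
      hd).congr_deriv ?_
    simp only [Pi.mul_apply]
    rw [hginv, div_eq_iff (pow_ne_zero 2 hd)]
    generalize (m x : ℂ)⁻¹ = N at key ⊢
    generalize den a b (m x) l = D at key hd ⊢
    generalize (m x : ℂ) = M at key ⊢
    clear hcb
    field_simp
    linear_combination gaugeDiag a b M l * key
  · refine (hasDerivAt_const x (0 : ℂ)).congr_deriv ?_
    rw [hginv, e1]
    field_simp
    ring
  · have e2 : b * l + conj a * l ^ 2 = den a b 1 l * l / (4 * conj b) := by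
      rw [e1]; field_simp
    refine (hg.inv hg0).congr_deriv ?_
    rw [neg_div, pow_two, mul_div_mul_left _ _ hg0, div_eq_mul_inv, hginv, e2]
    field_simp
    ring

end

section

/-! ### The periodic factor -/

variable {a b : ℂ} {c α β : ℝ} {v m k : ℝ → ℝ}

/-- The scale of the Lax flow of a profile. -/
noncomputable def scale (b : ℂ) (v : ℝ → ℝ) (x : ℝ) : ℝ := v x / (2 * ‖b‖)

/-- The diagonal entry of the Lax matrix of a profile. -/
noncomputable def slope (v : ℝ → ℝ) (x : ℝ) : ℝ := -deriv v x / (2 * v x)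

theorem den_scale (hb : b ≠ 0) (x : ℝ) (l : ℂ) :
    den a b (scale b v x) l = 4 * conj a * conj b * l + (v x : ℂ) ^ 2 := by
  have hb' : (‖b‖ : ℂ) ≠ 0 := by simpa using hb
  rw [den, mul_assoc 4 (conj b) b, ← norm_sq_eq, scale]
  push_cast
  field_simp
  ring

/-- If the quotient were `-t` with `t ≥ 0`, a convex combination `τ` of `v(x)²` and `v(0)²` would
satisfy `4āb̄l + τ = 0`, which puts `l` on the cut. -/
theorem IsProfile.den_div_mem_slitPlane (ha : a ≠ 0) (hb : b ≠ 0) (hv : IsProfile a b c v)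
    (ht : IsTurning a b c α β) {l : ℂ} (hl : l ∉ cut a b c) (x : ℝ) :
    den a b (scale b v x) l / den a b 1 l ∈ slitPlane := by
  have h1 : den a b 1 l = 4 * conj a * conj b * l + (v 0 : ℂ) ^ 2 := by
    rw [← den_scale hb, scale, hv.initial, div_self (by simpa using hb), ofReal_one]
  obtain ⟨hl0, hr0⟩ := hv.sq_mem_Icc ht 0
  obtain ⟨hlx, hrx⟩ := hv.sq_mem_Icc ht x
  have hd0 : den a b 1 l ≠ 0 := fun h => hl (ht.mem_cut ha hb (τ := v 0 ^ 2) ⟨hl0, hr0⟩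
    (by rw [ofReal_pow, ← h1, h]))
  by_contra hs
  rw [mem_slitPlane_iff, not_or, not_lt, not_not] at hs
  set z := den a b (scale b v x) l / den a b 1 l with hz
  obtain ⟨t, ht0, hzt⟩ : ∃ t : ℝ, 0 ≤ t ∧ z = -(t : ℂ) :=
    ⟨-z.re, by linarith [hs.1], Complex.ext (by simp) (by simpa using hs.2)⟩
  have hzd : den a b (scale b v x) l = -(t : ℂ) * den a b 1 l := by
    rw [← hzt, hz, div_mul_cancel₀ _ hd0]
  rw [den_scale hb, h1] at hzd
  have ht1 : 0 < 1 + t := by linarith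
  have ht1' : (1 : ℂ) + t ≠ 0 := by exact_mod_cast ht1.ne'
  refine hl (ht.mem_cut ha hb (τ := (v x ^ 2 + t * v 0 ^ 2) / (1 + t)) ⟨?_, ?_⟩ ?_)
  · rw [le_div_iff₀ ht1]; nlinarith
  · rw [div_le_iff₀ ht1]; nlinarith
  · push_cast
    field_simp
    linear_combination hzd

/-- The periodic factor of the Iwasawa factorization. -/
noncomputable def periodicFactor (a b : ℂ) (c : ℝ) (v : ℝ → ℝ) (ρ x : ℝ) (l : ℂ) : Mat2 :=
  NormedSpace.exp (((x : ℂ) * ((ρ : ℂ)⁻¹ * psiQuot a b v ρ l) - psiQuot a b v x l) •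
    scaledResidue a b c l) * gauge a b c (scale b v x) (slope v x) l

theorem det_periodicFactor (ρ x : ℝ) (l : ℂ) : (periodicFactor a b c v ρ x l).det = 1 := by
  rw [periodicFactor, Matrix.det_mul, det_exp_smul (trace_scaledResidue l), det_gauge, one_mul]

/-- Over a period the linear term and `psiQuot` grow by the same amount, and the gauge sees only `v`
and `v'`. -/
theorem periodicFactor_add_period (ha : a ≠ 0) (hb : b ≠ 0) (hv : IsProfile a b c v)
    (ht : IsTurning a b c α β) {ρ : ℝ} (hρ0 : 0 < ρ) (hρ : Function.Periodic v ρ) (x : ℝ) {l : ℂ}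
    (hl : l ∉ cut a b c) :
    periodicFactor a b c v ρ (x + ρ) l = periodicFactor a b c v ρ x l := by
  obtain ⟨δ, hδ, h⟩ := hv.exists_norm_ge ha hb ht hl
  have hρC : (ρ : ℂ) ≠ 0 := by exact_mod_cast hρ0.ne'
  have hd : deriv v (x + ρ) = deriv v x := by
    rw [← deriv_comp_add_const]
    congr 1
    exact funext hρ
  rw [periodicFactor, psiQuot_add_period hρ hv.continuous hδ h.self_of_nhds, periodicFactor, scale,
    scale, slope, slope, hd, hρ x]
  congr 3
  push_cast
  field_simp
  ring

theorem analyticAt_scaledResidue {𝕜 E : Type*} [RCLike 𝕜] [NormedAlgebra 𝕜 ℂ]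
    [NormedAddCommGroup E] [NormedSpace 𝕜 E] {l : E → ℂ} {q : E} (hl : AnalyticAt 𝕜 l q)
    (i j : Fin 2) : AnalyticAt 𝕜 (fun p => scaledResidue a b c (l p) i j) q := by
  fin_cases i <;> fin_cases j <;> simp [scaledResidue]
  · exact analyticAt_const.mul hl
  · exact analyticAt_const.add (analyticAt_const.mul hl)
  · exact (analyticAt_const.mul hl).add (analyticAt_const.mul (hl.pow 2))
  · exact (analyticAt_const.mul hl).neg

theorem analyticAt_periodicFactor (ha : a ≠ 0) (hb : b ≠ 0) (hv : IsProfile a b c v)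
    (ht : IsTurning a b c α β) (ρ : ℝ) {x : ℝ} {l : ℂ} (hl : l ∉ cut a b c) (i j : Fin 2) :
    AnalyticAt ℝ (fun q : ℝ × ℂ => periodicFactor a b c v ρ q.1 q.2 i j) (x, l) := by
  obtain ⟨δ, hδ, h⟩ := hv.exists_norm_ge ha hb ht hl
  have hsnd : AnalyticAt ℝ (fun q : ℝ × ℂ => q.2) (x, l) := analyticAt_snd
  have hx : AnalyticAt ℝ (fun q : ℝ × ℂ => (q.1 : ℂ)) (x, l) :=
    analyticAt_ofReal_fst (f := fun t => t) analyticAt_id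
  have hρ : AnalyticAt ℝ (fun q : ℝ × ℂ => psiQuot a b v ρ q.2) (x, l) :=
    ((analyticAt_psiQuot_param hv.continuous hδ h ρ).restrictScalars (𝕜 := ℝ)).comp_of_eq
      analyticAt_snd rfl
  have hψ := analyticAt_psiQuot (x₀ := x) hv.analytic hv.continuous hδ h
  have hva := hv.analytic x trivial
  have hscale : AnalyticAt ℝ (scale b v) x :=
    hva.div analyticAt_const (by simpa using hb)
  have hslope : AnalyticAt ℝ (slope v) x :=
    hva.deriv.neg.div (analyticAt_const.mul hva) (by simpa using (hv.pos x).ne')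
  have hlax := hv.isLaxFlow hb ht
  have hexp := analyticAt_exp_entry (𝕜 := ℝ) (q := (x, l)) (f := fun q : ℝ × ℂ =>
    ((q.1 : ℂ) * ((ρ : ℂ)⁻¹ * psiQuot a b v ρ q.2) - psiQuot a b v q.1 q.2) •
      scaledResidue a b c q.2) fun i j =>
    ((hx.mul (analyticAt_const.mul hρ)).sub hψ).mul (analyticAt_scaledResidue hsnd i j)
  have hgauge := analyticAt_gauge (𝕜 := ℝ) (a := a) (b := b) (c := c) (q := (x, l))
    (analyticAt_ofReal_fst hscale) (analyticAt_ofReal_fst hslope) hsnd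
    (ofReal_mem_slitPlane.2 (hlax.pos x)) (hv.den_div_mem_slitPlane ha hb ht hl x)
  simp only [periodicFactor, Matrix.mul_apply, Fin.sum_univ_two]
  exact ((hexp i 0).mul (hgauge 0 j)).add ((hexp i 1).mul (hgauge 1 j))

theorem analyticAt_periodicFactor_param (ha : a ≠ 0) (hb : b ≠ 0) (hv : IsProfile a b c v)
    (ht : IsTurning a b c α β) (ρ x : ℝ) {l : ℂ} (hl : l ∉ cut a b c) (i j : Fin 2) :
    AnalyticAt ℂ (fun l => periodicFactor a b c v ρ x l i j) l := by
  obtain ⟨δ, hδ, h⟩ := hv.exists_norm_ge ha hb ht hl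
  have hψ := fun y => analyticAt_psiQuot_param hv.continuous hδ h y
  have hlax := hv.isLaxFlow hb ht
  have hexp := analyticAt_exp_entry (𝕜 := ℂ) (q := l) (f := fun l : ℂ =>
    ((x : ℂ) * ((ρ : ℂ)⁻¹ * psiQuot a b v ρ l) - psiQuot a b v x l) •
      scaledResidue a b c l) fun i j =>
    ((analyticAt_const.mul (analyticAt_const.mul (hψ ρ))).sub (hψ x)).mul
      (analyticAt_scaledResidue analyticAt_id i j)
  have hgauge := analyticAt_gauge (𝕜 := ℂ) (a := a) (b := b) (c := c) (q := l)
    (M := fun _ => scale b v x) (K := fun _ => slope v x) (l := fun l => l)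
    analyticAt_const analyticAt_const analyticAt_id
    (ofReal_mem_slitPlane.2 (hlax.pos x)) (hv.den_div_mem_slitPlane ha hb ht hl x)
  simp only [periodicFactor, Matrix.mul_apply, Fin.sum_univ_two]
  exact ((hexp i 0).mul (hgauge 0 j)).add ((hexp i 1).mul (hgauge 1 j))

/-- Off the cut, the inverse of the positive factor is given by elliptic integrals. -/
theorem exp_mul_gauge_eq_adjugate (ha : a ≠ 0) (hb : b ≠ 0) (hv : IsProfile a b c v)
    (ht : IsTurning a b c α β) {B : ℝ → ℂ → Mat2} (hB : IsPosSolution a b (scale b v) (slope v) B)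
    (x : ℝ) {l : ℂ} (hl : l ∉ cut a b c) :
    NormedSpace.exp ((-psiQuot a b v x l) • scaledResidue a b c l) *
      gauge a b c (scale b v x) (slope v x) l = (B x l).adjugate := by
  obtain ⟨δ, hδ, h⟩ := hv.exists_norm_ge ha hb ht hl
  have hlax : IsLaxFlow a b c (scale b v) (slope v) := hv.isLaxFlow hb ht
  have hs := hv.den_div_mem_slitPlane ha hb ht hl
  refine hB.eq_adjugate (Z := fun x => NormedSpace.exp ((-psiQuot a b v x l) •
    scaledResidue a b c l) * gauge a b c (scale b v x) (slope v x) l) ?_ (fun t => ?_) x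
  -- At `x = 0` one has `m = 1` and `k = c`, so the gauge is the identity.
  · have hs0 := slitPlane_ne_zero (hs 0)
    rw [hlax.m_zero, ofReal_one] at hs0
    have hd1 : den a b 1 l ≠ 0 := fun h => hs0 (by rw [h, div_zero])
    have hg : gaugeDiag a b 1 l = 1 := by simp [gaugeDiag, div_self hd1]
    simp only [hlax.m_zero, hlax.k_zero]
    have e : gauge a b c ((1 : ℝ) : ℂ) (c : ℂ) l = 1 := by
      ext i j
      fin_cases i <;> fin_cases j <;> simp [gauge, hg]
    rw [e]
    simp [psiQuot]
  · have hψ := hasDerivAt_psiQuot hv.continuous hδ h.self_of_nhds t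
    rw [← den_scale hb] at hψ
    refine ((hasEntryDerivAt_exp_smul (scaledResidue a b c l) hψ.neg).mul
      (hlax.hasEntryDerivAt_gauge hb (hs t))).congr_deriv ?_
    simp only [Pi.neg_apply, exp_smul_mul_comm]
    rw [mul_sub, Matrix.mul_smul, neg_smul, Matrix.neg_mul, Matrix.smul_mul]
    simp only [mul_assoc]
    abel

/-- The factor `exp(-ψA) G` is the inverse of `B`, so `R = exp(ρ⁻¹σxA) B⁻¹`; both closed formulas
are rearrangements of this. -/
theorem periodicFactor_eq (ha : a ≠ 0) (hb : b ≠ 0) (hv : IsProfile a b c v)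
    (ht : IsTurning a b c α β) {B : ℝ → ℂ → Mat2} (hB : IsPosSolution a b (scale b v) (slope v) B)
    (ρ x : ℝ) {l : ℂ} (hl0 : l ≠ 0) (hl : l ∉ cut a b c) :
    periodicFactor a b c v ρ x l =
      NormedSpace.exp (((ρ : ℂ)⁻¹ * sigma a b v ρ l * x) • residue a b c l) *
        (B x l).adjugate := by
  rw [periodicFactor, sub_eq_add_neg, exp_smul_add, mul_assoc,
    exp_mul_gauge_eq_adjugate ha hb hv ht hB x hl, sigma, psi_eq_mul_psiQuot ha hb ρ hl0,
    scaledResidue_eq hl0, smul_smul]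
  congr 3
  ring

theorem differentiableAt_exp_residue (s : ℂ) {l : ℂ} (hl : l ≠ 0) (i j : Fin 2) :
    DifferentiableAt ℂ (fun l => (NormedSpace.exp (s • residue a b c l)) i j) l := by
  refine (analyticAt_exp_entry (𝕜 := ℂ) (fun i j => ?_) i j).differentiableAt
  have hinv : AnalyticAt ℂ (fun l : ℂ => l⁻¹) l := analyticAt_id.inv hl
  have hid : AnalyticAt ℂ (fun l : ℂ => l) l := analyticAt_id
  fin_cases i <;> fin_cases j <;> simp [residue]
  · exact analyticAt_const
  · exact analyticAt_const.mul ((analyticAt_const.mul hinv).add analyticAt_const)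
  · exact analyticAt_const.mul (analyticAt_const.add (analyticAt_const.mul hid))
  · exact analyticAt_const

theorem differentiable_adjugate_entry {Y : ℂ → Mat2}
    (hY : ∀ i j, Differentiable ℂ fun l => Y l i j) (i j : Fin 2) :
    Differentiable ℂ fun l => (Y l).adjugate i j := by
  simp only [Matrix.adjugate_fin_two]
  fin_cases i <;> fin_cases j <;> simp
  · exact hY 1 1
  · exact hY 0 1
  · exact hY 1 0
  · exact hY 0 0

theorem differentiableOn_exp_mul_adjugate {B : ℂ → Mat2}
    (hB : ∀ i j, Differentiable ℂ fun l => B l i j) (s : ℂ) (i j : Fin 2) :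
    DifferentiableOn ℂ
      (fun l => (NormedSpace.exp (s • residue a b c l) * (B l).adjugate) i j) {0}ᶜ := by
  intro l hl
  simp only [Matrix.mul_apply, Fin.sum_univ_two]
  have h1 := fun i j => differentiableAt_exp_residue (a := a) (b := b) (c := c) s hl i j
  have h2 := fun i j => differentiable_adjugate_entry hB i j l
  exact (((h1 i 0).mul (h2 0 j)).add ((h1 i 1).mul (h2 1 j))).differentiableWithinAt

theorem IsPosSolution.isTheIwasawa {B : ℝ → ℂ → Mat2} (hB : IsPosSolution a b m k B)
    (h : IsLaxFlow a b c m k) (x y : ℝ) :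
    IsTheIwasawa (fun z : Circle => NormedSpace.exp (((x : ℂ) + I * y) • residue a b c z))
      (fun z : Circle => NormedSpace.exp (((x : ℂ) + I * y) • residue a b c z) *
        (B x z).adjugate)
      (fun z : Circle => B x z) := by
  have hBdet := hB.det_eq_one x
  have hadj : ∀ l, (B x l).adjugate.det = 1 := fun l => by
    rw [Matrix.det_adjugate, hBdet, one_pow]
  have hdet : ∀ l, (NormedSpace.exp (((x : ℂ) + I * y) • residue a b c l) *
      (B x l).adjugate).det = 1 := fun l => by
    rw [Matrix.det_mul, det_exp_smul (trace_residue l), hadj, one_mul]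
  have hI : IsIwasawa (fun z : Circle => NormedSpace.exp (((x : ℂ) + I * y) • residue a b c z))
      (fun z : Circle => NormedSpace.exp (((x : ℂ) + I * y) • residue a b c z) *
        (B x z).adjugate)
      (fun z : Circle => B x z) := by
    refine ⟨⟨⟨fun z => hdet z, fun l => NormedSpace.exp (((x : ℂ) + I * y) • residue a b c l) *
        (B x l).adjugate, fun i j l hl => ?_, fun z => rfl⟩, fun z => ?_⟩,
      ⟨⟨fun z => hBdet z, B x, fun i j l _ => ?_, fun z => rfl⟩, B x,
        fun i j => (hB.differentiable x i j).diffContOnCl, fun l _ => hBdet l, fun z => rfl,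
        hB.zero_right x⟩, fun z => ?_⟩
    · have hl0 : l ∈ ({0}ᶜ : Set ℂ) := by
        intro h0
        rw [Set.mem_singleton_iff.1 h0, mem_sphere_zero_iff_norm, norm_zero] at hl
        exact zero_ne_one hl
      exact (differentiableOn_exp_mul_adjugate (hB.differentiable x) _ i j).analyticAt
        (isOpen_compl_singleton.mem_nhds hl0)
    · exact (Matrix.inv_eq_right_inv (hB.exp_mul_adjugate_unitary h x y (Circle.coe_ne_zero z)
        (by rw [← Circle.coe_inv_eq_conj, Circle.coe_inv]))).symm
    · exact (hB.differentiable x i j).analyticAt l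
    · rw [mul_assoc, adjugate_mul_self (hBdet z), mul_one]
  exact ⟨hI, fun F' B' h' => hI.unique h'⟩

end

end Delaunay

/-! ### Assembly of the theorem. -/

theorem mainTheorem11 (a b : ℂ) (ha : a ≠ 0) (hb : b ≠ 0) (c : ℝ) :
    (∃! v : ℝ → ℝ, Delaunay.IsProfile a b c v) ∧
    ∀ v : ℝ → ℝ, Delaunay.IsProfile a b c v →
      Delaunay.IsRestrictionOfElliptic v ∧
      ∀ ρ : ℝ, 0 < ρ → Function.Periodic v ρ →
        ∃ R : ℝ → ℂ → Mat2,
          -- `R` is analytic in `(x, l)` and holomorphic in `l` off the cut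
          (∀ i j, AnalyticOnNhd ℝ (fun q : ℝ × ℂ => R q.1 q.2 i j)
            (Set.univ ×ˢ (Delaunay.cut a b c)ᶜ)) ∧
          (∀ x i j, DifferentiableOn ℂ (fun l => R x l i j) (Delaunay.cut a b c)ᶜ) ∧
          (∀ x, ∀ l ∉ Delaunay.cut a b c, (R x l).det = 1) ∧
          (∀ x, ∀ l ∉ Delaunay.cut a b c, R (x + ρ) l = R x l) ∧
          -- the Iwasawa factors extend holomorphically and are given off the cut by the formulas
          ∀ x y : ℝ, ∃ F B : ℂ → Mat2,
            (∀ i j, DifferentiableOn ℂ (fun l => F l i j) {0}ᶜ) ∧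
            (∀ i j, Differentiable ℂ (fun l => B l i j)) ∧
            Delaunay.IsTheIwasawa
              (fun z : Circle =>
                NormedSpace.exp (((x : ℂ) + Complex.I * y) • Delaunay.residue a b c z))
              (fun z : Circle => F z) (fun z : Circle => B z) ∧
            ∀ l : ℂ, l ≠ 0 → l ∉ Delaunay.cut a b c →
              F l = NormedSpace.exp
                  (((x : ℂ) + Complex.I * y - (ρ : ℂ)⁻¹ * Delaunay.sigma a b v ρ l * x) •
                    Delaunay.residue a b c l) * R x l ∧
              B l = (R x l)⁻¹ * NormedSpace.exp
                  (((ρ : ℂ)⁻¹ * Delaunay.sigma a b v ρ l * x) • Delaunay.residue a b c l) := by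
  obtain ⟨w, hw, hell⟩ := Delaunay.exists_isProfile ha hb c
  -- Uniqueness transfers ellipticity from the constructed profile to `v`.
  refine ⟨⟨w, hw, fun u hu => hu.eq ha hb hw⟩, fun v hv => ⟨hv.eq ha hb hw ▸ hell, ?_⟩⟩
  intro ρ hρ hper
  obtain ⟨α, β, ht⟩ := Delaunay.exists_isTurning ha hb c
  have hlax : Delaunay.IsLaxFlow a b c (Delaunay.scale b v) (Delaunay.slope v) :=
    hv.isLaxFlow hb ht
  obtain ⟨B, hB⟩ := hlax.exists_isPosSolution
  refine ⟨Delaunay.periodicFactor a b c v ρ,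
    fun i j q hq => Delaunay.analyticAt_periodicFactor ha hb hv ht ρ hq.2 i j,
    fun x i j l hl => (Delaunay.analyticAt_periodicFactor_param ha hb hv ht ρ x hl i
      j).differentiableAt.differentiableWithinAt,
    fun x l _ => Delaunay.det_periodicFactor ρ x l,
    fun x l hl => Delaunay.periodicFactor_add_period ha hb hv ht hρ hper x hl, fun x y => ?_⟩
  refine ⟨fun l => NormedSpace.exp (((x : ℂ) + Complex.I * y) • Delaunay.residue a b c l) *
      (B x l).adjugate, B x,
    Delaunay.differentiableOn_exp_mul_adjugate (hB.differentiable x) _, hB.differentiable x,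
    hB.isTheIwasawa hlax x y, fun l hl0 hl => ?_⟩
  have hR := Delaunay.periodicFactor_eq ha hb hv ht hB ρ x hl0 hl
  constructor
  · rw [hR, ← mul_assoc, ← Delaunay.exp_smul_add, sub_add_cancel]
  · have hdet := Delaunay.det_periodicFactor (a := a) (b := b) (c := c) (v := v) ρ x l
    have h1 : Delaunay.periodicFactor a b c v ρ x l * B x l =
        NormedSpace.exp (((ρ : ℂ)⁻¹ * Delaunay.sigma a b v ρ l * x) •
          Delaunay.residue a b c l) := by
      rw [hR, mul_assoc, Delaunay.adjugate_mul_self (hB.det_eq_one x l), mul_one]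
    rw [← h1, ← mul_assoc, Matrix.nonsing_inv_mul _ (by rw [hdet]; exact isUnit_one), one_mul]
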